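/- **Theorem 2.4.** Let $H$ be a finite bipartite graph with $h$ vertices and $\ell$ edges that contains a cycle. For a graph $G$ let $\mathrm{ex}(G,H)$ be the maximum number of edges in an $H$-free subgraph of $G$, and let $\mathrm{ex}(n,H)=\mathrm{ex}(K_n,H)$. Let $A>0$ and $0<\alpha<2$ be reals such that $\mathrm{ex}(n,H)\le A n^{\alpha}$ for every $n\in\mathbb N$. Suppose that $H$ is Erdős–Simonovits good (for the exponent $\alpha$): there are constants $K,c>0$ such that for all sufficiently large $n$, every $n$-vertex graph $G$ with $e(G)>Kn^{\alpha}$ edges contains at least $c\,e(G)^{\ell}/n^{2\ell-h}$ copies of $H$ (subgraphs of $G$ isomorphic to $H$). Put $$m_2^*(H)=\max\Big\{\frac{e(F)-1}{v(F)-2}: F\subsetneq H,\ v(F)>2\Big\},\qquad \phi=\frac{\alpha\ell-\alpha+h-2\ell}{\ell-1},\qquad \lambda^*=\frac{1}{m_2^*(H)(2-\alpha)},$$ and assume $\lambda^*\ne 1$, so that the exponents below are defined. Then there is a constant $C=C(\alpha,H)>0$ such that, for every function $p=p(n)\in[0,1]$, with probability tending to $1$ as $n\to\infty$, $$\mathrm{ex}(G(n,p),H)\le\begin{cases}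 C\,n^{\alpha-\phi}(\log n)^2 & \text{if } p\le n^{-\frac{\phi\lambda^*}{\lambda^*-1}}(\log n)^{\frac{2\lambda^*}{\lambda^*-1}},\\[4pt] C\,p^{\,1-1/\lambda^*}\,n^{\alpha} & \text{otherwise.}\end{cases}$$ -/

import Mathlib

open Filter Topology

namespace RandomTuran

/-- `ex(G, H)`: the largest number of edges in an `H`-free subgraph of the finite graph `G`. -/
noncomputable def exIn {W V : Type*} [Finite W] (G : SimpleGraph W) (H : SimpleGraph V) : ℕ :=
  sSup {m : ℕ | ∃ F : SimpleGraph W, F ≤ G ∧ H.Free F ∧ m = F.edgeSet.ncard}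

/-- The set of values `(e(F) - 1) / (v(F) - 2)` over proper subgraphs `F ⊊ H` with `v(F) > 2`. -/
def properTwoDensities {V : Type*} (H : SimpleGraph V) : Set ℝ :=
  {x : ℝ | ∃ F : H.Subgraph, F ≠ ⊤ ∧ 2 < F.verts.ncard ∧
    x = ((F.edgeSet.ncard : ℝ) - 1) / ((F.verts.ncard : ℝ) - 2)}

/-- The proper `2`-density `m*₂(H)` of a finite graph `H` (a maximum of a finite set). -/
noncomputable def properTwoDensity {V : Type*} [Finite V] (H : SimpleGraph V) : ℝ :=
  sSup (properTwoDensities H)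

/-- The set over which the maximum `m*₂(H)` is taken is finite. -/
theorem properTwoDensities_finite {V : Type*} [Finite V] (H : SimpleGraph V) :
    (properTwoDensities H).Finite := by
  refine (Set.finite_range (fun F : H.Subgraph =>
    ((F.edgeSet.ncard : ℝ) - 1) / ((F.verts.ncard : ℝ) - 2))).subset ?_
  rintro x ⟨F, -, -, rfl⟩
  exact ⟨F, rfl⟩

/-- `φ(α, H) = (α ℓ - α + h - 2 ℓ) / (ℓ - 1)`, where `h = v(H)` and `ℓ = e(H)`. -/
noncomputable def phi {V : Type*} [Finite V] (H : SimpleGraph V) (α : ℝ) : ℝ :=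
  (α * (H.edgeSet.ncard : ℝ) - α + (Nat.card V : ℝ) - 2 * (H.edgeSet.ncard : ℝ)) /
    ((H.edgeSet.ncard : ℝ) - 1)

/-- `λ*(α, H) = 1 / (m*₂(H) (2 - α))`. -/
noncomputable def lambdaStar {V : Type*} [Finite V] (H : SimpleGraph V) (α : ℝ) : ℝ :=
  1 / (properTwoDensity H * (2 - α))

/-- `H` is Erdős–Simonovits good (for the exponent `α`): there are constants `K, c > 0` such that,
for all sufficiently large `n`, every `n`-vertex graph `G` with `e(G) > K n ^ α` contains at least
`c e(G) ^ ℓ / n ^ (2 ℓ - h)` copies of `H`, where `h = v(H)` and `ℓ = e(H)`. -/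
def ErdosSimonovitsGood {V : Type*} [Finite V] (H : SimpleGraph V) (α : ℝ) : Prop :=
  ∃ K c : ℝ, 0 < K ∧ 0 < c ∧ ∀ᶠ n : ℕ in atTop, ∀ G : SimpleGraph (Fin n),
    K * (n : ℝ) ^ α < (G.edgeSet.ncard : ℝ) →
      c * (G.edgeSet.ncard : ℝ) ^ H.edgeSet.ncard /
          (n : ℝ) ^ (2 * (H.edgeSet.ncard : ℤ) - (Nat.card V : ℤ))
        ≤ (G.copyCount H : ℝ)

end RandomTuran

/-! View the pairs in `Fin n` as the vertices of a hypergraph whose edges are the copies of `H`. An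
`H`-free graph is then an independent set, and the theorem follows from a union bound over
containers for these sets. Write λ for `lambdaStar H α` and φ for `phi H α`.

Balanced supersaturation (`balanced_supersaturation`). Any k n^α pairs with k large carry at least ρ
κ k n^α labelled copies of `H` such that j ≥ 1 given pairs lie together in at most κ τ^(j-1) of
them. Here τ can be taken as small as max(k^(-λ), 1/(k n^φ)). Take a maximal family obeying the
degree bounds. If it is too small, pass to a random vertex set of size about n k^(-1/(2-α)), where
the number of edges is a constant factor above the Erdős–Simonovits threshold, and delete one edge
from each nearly saturated set that survives. The density m*₂ ensures that few survive, so goodness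
yields more copies than the family has there, and a new one can be added. The number φ appears
because the guaranteed number of copies per edge is of order (k n^φ)^(ℓ-1).

Containers (`exists_container_tree`). Under such degree bounds, each independent set has a
fingerprint of O(τ|X| + 1) elements, which determines a set of at most (1-δ)|X| elements containing
the rest.

Iteration (`exists_container_family`, `exists_freeSet_family`). Containers are shrunk to about
q^(-1/λ) n^α pairs, where q is the larger of p and the threshold. A step at level k costs a
fingerprint of order k^(1-λ) n^α + n^(α-φ) + 1. As λ > 1, the first term decays geometrically in the
level, so the last step dominates and gives x = q^(1-1/λ) n^α. The other terms occur in O(log n)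
steps, each with entropy factor O(log n), which produces (log n)². The threshold for p is where both
contributions agree. A union bound over fingerprints and over large subsets of containers
(`binomialRandom_exIn_le`) then finishes.

That λ ≥ 1 comes from the deletion method: a dense subgraph of `H` would force ex(n, H) above A n^α
(`sub_one_mul_le_of_extremalNumber_le`). If φ ≤ 0, the threshold is at least 1 and the deterministic
bound on ex(n, H) suffices. -/

namespace RandomTuran

/-! ### Decision trees and fingerprints -/

/-- A decision tree that adaptively asks whether elements of `E` belong to an unknown set. -/
inductive QueryTree (E β : Type*) where
  | leaf (b : β) : QueryTree E β
  | node (v : E) (yes no : QueryTree E β) : QueryTree E β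

namespace QueryTree

variable {E β γ : Type*} [DecidableEq E]

/-- The label of the leaf reached when the answers are given by the set `I`. -/
def out : QueryTree E β → Finset E → β
  | leaf b, _ => b
  | node v y n, I => if v ∈ I then y.out I else n.out I

/-- The set of positively answered queries when the answers are given by the set `I`. -/
def yes : QueryTree E β → Finset E → Finset E
  | leaf _, _ => ∅
  | node v y n, I => if v ∈ I then insert v (y.yes I) else n.yes I

/-- Replace every leaf of a tree by a tree. -/
def bind : QueryTree E β → (β → QueryTree E γ) → QueryTree E γ
  | leaf b, g => g b
  | node v y n, g => node v (y.bind g) (n.bind g)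

theorem yes_subset (t : QueryTree E β) (I : Finset E) : t.yes I ⊆ I := by
  induction t with
  | leaf b => simp [yes]
  | node v y n hy hn =>
    simp only [yes]
    split_ifs with h
    · exact Finset.insert_subset h hy
    · exact hn

theorem out_bind (t : QueryTree E β) (g : β → QueryTree E γ) (I : Finset E) :
    (t.bind g).out I = (g (t.out I)).out I := by
  induction t with
  | leaf b => rfl
  | node v y n hy hn => simp only [bind, out]; split_ifs <;> assumption

theorem yes_bind (t : QueryTree E β) (g : β → QueryTree E γ) (I : Finset E) :
    (t.bind g).yes I = t.yes I ∪ (g (t.out I)).yes I := by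
  induction t with
  | leaf b => simp [bind, yes, out]
  | node v y n hy hn =>
    simp only [bind, yes, out]; split_ifs
    · rw [hy, Finset.insert_union]
    · exact hn

/-- The leaf reached depends only on the set of positive answers. -/
theorem out_eq_of_yes_subset (t : QueryTree E β) {I J : Finset E} (hJ : J ⊆ I)
    (h : t.yes I ⊆ J) : t.out J = t.out I := by
  induction t with
  | leaf b => rfl
  | node v y n hy hn =>
    simp only [yes] at h
    simp only [out]
    split_ifs at h with hv
    · have := Finset.insert_subset_iff.1 h
      rw [if_pos this.1, if_pos hv, hy this.2]
    · rw [if_neg (fun h' => hv (hJ h')), if_neg hv, hn h]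

end QueryTree

/-! ### Weighted hypergraphs, degrees and links -/

section Degree

variable {E : Type*} [Fintype E] [DecidableEq E]

/-- The degree of the set `σ` in the hypergraph with edge weights `w`. -/
def wdeg (w : Finset E → ℝ) (σ : Finset E) : ℝ := ∑ e with σ ⊆ e, w e

/-- The link of the vertex `v` in a weighted hypergraph. -/
def wlink (w : Finset E → ℝ) (v : E) (e : Finset E) : ℝ := if v ∈ e then 0 else w (insert v e)

/-- The set `I` contains no edge of positive weight. -/
def WIndep (w : Finset E → ℝ) (I : Finset E) : Prop := ∀ e ⊆ I, w e = 0

/-- The weighted hypergraph `w` is `s`-uniform with vertex set `X`, and every nonempty set `σ`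
has degree at most `κ τ ^ (|σ| - 1)`. -/
structure Bounded (X : Finset E) (s : ℕ) (κ τ : ℝ) (w : Finset E → ℝ) : Prop where
  nonneg : ∀ e, 0 ≤ w e
  subset : ∀ e, w e ≠ 0 → e ⊆ X
  card : ∀ e, w e ≠ 0 → e.card = s
  deg : ∀ σ : Finset E, σ.Nonempty → wdeg w σ ≤ κ * τ ^ (σ.card - 1)

theorem wdeg_mono {w w' : Finset E → ℝ} (h : ∀ e, w e ≤ w' e) (σ : Finset E) :
    wdeg w σ ≤ wdeg w' σ := Finset.sum_le_sum fun e _ => h e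

theorem wdeg_nonneg {w : Finset E → ℝ} (h : ∀ e, 0 ≤ w e) (σ : Finset E) : 0 ≤ wdeg w σ :=
  Finset.sum_nonneg fun e _ => h e

theorem wdeg_empty (w : Finset E → ℝ) : wdeg w ∅ = ∑ e, w e := by simp [wdeg]

theorem wdeg_add (w w' : Finset E → ℝ) (σ : Finset E) :
    wdeg (fun e => w e + w' e) σ = wdeg w σ + wdeg w' σ := Finset.sum_add_distrib

theorem wdeg_wlink (w : Finset E → ℝ) (v : E) (σ : Finset E) :
    wdeg (wlink w v) σ = if v ∈ σ then 0 else wdeg w (insert v σ) := by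
  split_ifs with hv
  · refine Finset.sum_eq_zero fun e he => ?_
    rw [Finset.mem_filter] at he
    simp [wlink, he.2 hv]
  · have : wdeg (wlink w v) σ = ∑ e with (σ ⊆ e ∧ v ∉ e), w (insert v e) := by
      rw [wdeg, ← Finset.filter_filter, Finset.sum_filter (fun e => v ∉ e)]
      exact Finset.sum_congr rfl fun e _ => by by_cases h : v ∈ e <;> simp [wlink, h]
    rw [this, wdeg]
    refine Finset.sum_bij' (fun e _ => insert v e) (fun e _ => e.erase v) ?_ ?_ ?_ ?_ ?_
    · intro e he
      simp only [Finset.mem_filter, Finset.mem_univ, true_and] at he ⊢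
      exact Finset.insert_subset_insert _ he.1
    · intro e he
      simp only [Finset.mem_filter, Finset.mem_univ, true_and] at he ⊢
      exact ⟨fun x hx => Finset.mem_erase.2 ⟨fun h => hv (h ▸ hx),
        he (Finset.mem_insert_of_mem hx)⟩, Finset.notMem_erase _ _⟩
    · intro e he
      simp only [Finset.mem_filter, Finset.mem_univ, true_and] at he
      exact Finset.erase_insert he.2
    · intro e he
      simp only [Finset.mem_filter, Finset.mem_univ, true_and] at he
      exact Finset.insert_erase (he (Finset.mem_insert_self _ _))
    · intro e _; rfl

theorem sum_wdeg_singleton (w : Finset E → ℝ) (R : Finset E) :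
    ∑ v ∈ R, wdeg w {v} = ∑ e, (R ∩ e).card * w e := by
  simp only [wdeg, Finset.singleton_subset_iff, Finset.sum_filter]
  rw [Finset.sum_comm]
  refine Finset.sum_congr rfl fun e _ => ?_
  rw [← Finset.sum_filter, Finset.sum_const, nsmul_eq_mul, Finset.filter_mem_eq_inter]

/-- Each edge is counted once for each of its subsets. For uniform `w` this bounds the total degree
of the saturated sets by a constant times the total weight. -/
theorem sum_wdeg (w : Finset E → ℝ) : ∑ σ, wdeg w σ = ∑ e, 2 ^ e.card * w e := by
  simp only [wdeg, Finset.sum_filter]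
  rw [Finset.sum_comm]
  refine Finset.sum_congr rfl fun e _ => ?_
  rw [← Finset.sum_filter, Finset.sum_const, nsmul_eq_mul]
  have : (Finset.univ.filter fun σ => σ ⊆ e) = e.powerset := by ext; simp
  rw [this, Finset.card_powerset]
  push_cast; rfl

/-- Averaging: the edges are nonempty and lie in `R`, so the degrees over `R` sum to at least the
total weight. -/
theorem exists_le_card_mul_wdeg {w : Finset E → ℝ} {R : Finset E} (h0 : ∀ e, 0 ≤ w e)
    (hR : ∀ e, w e ≠ 0 → e ⊆ R ∧ e.Nonempty) (hpos : 0 < ∑ e, w e) :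
    ∃ v ∈ R, ∑ e, w e ≤ R.card * wdeg w {v} := by
  have key : ∑ e, w e ≤ ∑ v ∈ R, wdeg w {v} := by
    rw [sum_wdeg_singleton]
    refine Finset.sum_le_sum fun e _ => ?_
    by_cases he : w e = 0
    · simp [he]
    · obtain ⟨h1, h2⟩ := hR e he
      rw [Finset.inter_eq_right.2 h1]
      have : (1 : ℝ) ≤ e.card := by exact_mod_cast h2.card_pos
      nlinarith [h0 e]
  have hne : R.Nonempty := by
    by_contra h
    rw [Finset.not_nonempty_iff_eq_empty] at h
    subst h
    simp at key; linarith
  have hc : (0 : ℝ) < R.card := by exact_mod_cast hne.card_pos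
  obtain ⟨v, hv, hle⟩ := Finset.exists_le_of_sum_le (f := fun _ => (∑ e, w e) / R.card) hne
    (by simpa [mul_div_cancel₀ _ hc.ne'] using key)
  exact ⟨v, hv, by rw [div_le_iff₀ hc] at hle; linarith⟩

/-- The edges that lie in `R` and contain no set whose degree in `B` is saturated. -/
noncomputable def unsaturated (w B : Finset E → ℝ) (κ τ : ℝ) (R : Finset E) (e : Finset E) : ℝ :=
  open Classical in
  if e ⊆ R ∧ ∀ σ ⊆ e, σ.Nonempty → wdeg B σ < κ * τ ^ σ.card then w e else 0

end Degree
-- The container algorithm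
section Stage

variable {E : Type*} [Fintype E] [DecidableEq E]

theorem unsaturated_nonneg {w B : Finset E → ℝ} {κ τ : ℝ} {R : Finset E} (h : ∀ e, 0 ≤ w e)
    (e : Finset E) : 0 ≤ unsaturated w B κ τ R e := by
  unfold unsaturated; split_ifs
  · exact h e
  · exact le_rfl

theorem unsaturated_le {w B : Finset E → ℝ} {κ τ : ℝ} {R : Finset E} (h : ∀ e, 0 ≤ w e)
    (e : Finset E) : unsaturated w B κ τ R e ≤ w e := by
  unfold unsaturated; split_ifs
  · exact le_rfl
  · exact h e

theorem of_unsaturated_ne_zero {w B : Finset E → ℝ} {κ τ : ℝ} {R e : Finset E}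
    (h : unsaturated w B κ τ R e ≠ 0) :
    w e ≠ 0 ∧ e ⊆ R ∧ ∀ σ ⊆ e, σ.Nonempty → wdeg B σ < κ * τ ^ σ.card := by
  unfold unsaturated at h
  split_ifs at h with h'
  · exact ⟨h, h'⟩
  · exact absurd rfl h

/-- The total weight lost by passing to unsaturated edges. -/
theorem sum_sub_unsaturated_le {X : Finset E} {s : ℕ} {κ τ : ℝ} {w B : Finset E → ℝ}
    (hτ : 0 < τ) (hw : Bounded X (s + 1) κ τ w)
    (hB : ∀ e, 0 ≤ B e) (hBs : ∀ e, B e ≠ 0 → e.card = s) (R : Finset E) :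
    ∑ e, w e ≤ ∑ e, unsaturated w B κ τ R e + (X \ R).card * κ + 2 ^ s * (∑ e, B e) / τ := by
  classical
  set sat : Finset (Finset E) :=
    Finset.univ.filter fun σ => σ.Nonempty ∧ κ * τ ^ σ.card ≤ wdeg B σ with hsat
  -- An edge is lost either because it has a vertex in `X \ R` or because it contains a saturated
  -- set.
  have h1 : ∑ e, w e ≤ ∑ e, (unsaturated w B κ τ R e + ∑ v ∈ X \ R, (if v ∈ e then w e else 0) +
      ∑ σ ∈ sat, (if σ ⊆ e then w e else 0)) := by
    refine Finset.sum_le_sum fun e _ => ?_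
    have n1 : 0 ≤ ∑ v ∈ X \ R, (if v ∈ e then w e else 0) :=
      Finset.sum_nonneg fun v _ => by split_ifs <;> simp [hw.nonneg]
    have n2 : 0 ≤ ∑ σ ∈ sat, (if σ ⊆ e then w e else 0) :=
      Finset.sum_nonneg fun v _ => by split_ifs <;> simp [hw.nonneg]
    have n3 := unsaturated_nonneg (B := B) (κ := κ) (τ := τ) (R := R) hw.nonneg e
    by_cases he0 : w e = 0
    · exact he0.le.trans (by positivity)
    by_cases heR : e ⊆ R
    · by_cases hs : ∀ σ ⊆ e, σ.Nonempty → wdeg B σ < κ * τ ^ σ.card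
      · have : unsaturated w B κ τ R e = w e := if_pos ⟨heR, hs⟩
        rw [this]; linarith
      · push Not at hs
        obtain ⟨σ, hσe, hσn, hσ⟩ := hs
        have hmem : σ ∈ sat := by simp [hsat, hσn, hσ]
        have := Finset.single_le_sum (f := fun σ => if σ ⊆ e then w e else 0)
          (fun v _ => by split_ifs <;> simp [hw.nonneg]) hmem
        simp only [hσe, if_true] at this
        linarith
    · obtain ⟨v, hve, hvR⟩ := Finset.not_subset.1 heR
      have hmem : v ∈ X \ R := Finset.mem_sdiff.2 ⟨hw.subset e he0 hve, hvR⟩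
      have := Finset.single_le_sum (f := fun v => if v ∈ e then w e else 0)
          (fun v _ => by split_ifs <;> simp [hw.nonneg]) hmem
      simp only [hve, if_true] at this
      linarith
  rw [Finset.sum_add_distrib, Finset.sum_add_distrib] at h1
  have h2 : ∑ e, ∑ v ∈ X \ R, (if v ∈ e then w e else 0) ≤ (X \ R).card * κ := by
    rw [Finset.sum_comm]
    refine (Finset.sum_le_card_nsmul _ _ κ fun v _ => ?_).trans (by rw [nsmul_eq_mul])
    have := hw.deg {v} (Finset.singleton_nonempty v)
    simp only [Finset.card_singleton, Nat.sub_self, pow_zero, mul_one] at this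
    simpa [wdeg, Finset.sum_filter] using this
  have h3 : ∑ e, ∑ σ ∈ sat, (if σ ⊆ e then w e else 0) ≤ 2 ^ s * (∑ e, B e) / τ := by
    rw [Finset.sum_comm]
    -- Saturation means that the `B`-degree of `σ` is at least τ times the largest `w`-degree
    -- allowed for `σ`, so the weight lost is charged to `B`.
    have : ∀ σ ∈ sat, ∑ e, (if σ ⊆ e then w e else 0) ≤ wdeg B σ / τ := by
      intro σ hσ
      simp only [hsat, Finset.mem_filter, Finset.mem_univ, true_and] at hσ
      have := hw.deg σ hσ.1
      rw [wdeg, Finset.sum_filter] at this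
      refine this.trans ?_
      rw [le_div_iff₀ hτ]
      refine le_trans (le_of_eq ?_) hσ.2
      rw [mul_assoc, ← pow_succ, Nat.sub_add_cancel hσ.1.card_pos]
    refine (Finset.sum_le_sum this).trans ?_
    rw [← Finset.sum_div]
    gcongr
    refine (Finset.sum_le_univ_sum_of_nonneg fun σ => wdeg_nonneg hB σ).trans ?_
    rw [sum_wdeg, Finset.mul_sum]
    refine le_of_eq (Finset.sum_congr rfl fun e _ => ?_)
    by_cases he : B e = 0
    · simp [he]
    · rw [hBs e he]
  linarith

/-- Adding the link of a vertex keeps degrees under control. -/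
theorem Bounded.add_wlink {X R : Finset E} {s : ℕ} {κ τ : ℝ} {w B : Finset E → ℝ}
    (hw : Bounded X (s + 1) κ τ w) (hB : Bounded X s (2 * κ * τ) τ B)
    (v : E) :
    Bounded X s (2 * κ * τ) τ (fun e => B e + wlink (unsaturated w B κ τ R) v e) := by
  set A := unsaturated w B κ τ R with hA
  have hAn : ∀ e, 0 ≤ A e := unsaturated_nonneg hw.nonneg
  have hln : ∀ e, 0 ≤ wlink A v e := fun e => by unfold wlink; split_ifs <;> simp [hAn]
  have hl : ∀ e, wlink A v e ≠ 0 → v ∉ e ∧ A (insert v e) ≠ 0 := fun e he => by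
    unfold wlink at he
    split_ifs at he with h
    · exact absurd rfl he
    · exact ⟨h, he⟩
  refine ⟨fun e => add_nonneg (hB.nonneg e) (hln e), fun e he => ?_, fun e he => ?_,
    fun σ hσ => ?_⟩
  · by_cases h : B e = 0
    · have := hl e (by simpa [h] using he)
      exact (Finset.subset_insert v e).trans (hw.subset _ (of_unsaturated_ne_zero this.2).1)
    · exact hB.subset e h
  · by_cases h : B e = 0
    · have := hl e (by simpa [h] using he)
      have hc := hw.card _ (of_unsaturated_ne_zero this.2).1
      rw [Finset.card_insert_of_notMem this.1] at hc
      omega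
    · exact hB.card e h
  · rw [wdeg_add, wdeg_wlink]
    split_ifs with hv
    · simpa using hB.deg σ hσ
    -- If the link adds weight at `σ`, some unsaturated edge contains `σ`. The old degree is then
    -- below κ τ^|σ| and the increment is at most κ τ^|σ|, which explains the factor 2 in `2 * κ *
    -- τ`.
    · by_cases h0 : wdeg A (insert v σ) = 0
      · rw [h0, add_zero]; exact hB.deg σ hσ
      · obtain ⟨e, he, hne⟩ := Finset.exists_ne_zero_of_sum_ne_zero h0
        rw [Finset.mem_filter] at he
        have h1 := (of_unsaturated_ne_zero hne).2.2 σ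
          ((Finset.subset_insert v σ).trans he.2) hσ
        have h2 : wdeg A (insert v σ) ≤ κ * τ ^ σ.card := by
          refine (wdeg_mono (unsaturated_le hw.nonneg) _).trans ?_
          have := hw.deg (insert v σ) (Finset.insert_nonempty v σ)
          rwa [Finset.card_insert_of_notMem hv, Nat.add_sub_cancel] at this
        calc _ ≤ 2 * (κ * τ ^ σ.card) := by linarith
          _ = 2 * κ * τ * τ ^ (σ.card - 1) := by
            obtain ⟨j, hj⟩ := Nat.exists_eq_succ_of_ne_zero hσ.card_pos.ne'
            rw [hj]; simp [pow_succ]; ring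

/-- From a state with vertices `S` answered positively and vertices `R` remaining, one finds either
a small container or a suitable `s`-uniform hypergraph. -/
theorem exists_tree_of_state {X : Finset E} {s : ℕ} {κ τ a : ℝ} {w : Finset E → ℝ}
    (hκ : 0 < κ) (hτ : 0 < τ) (ha : 0 < a) (hw : Bounded X (s + 1) κ τ w) (hX : X.Nonempty)
    (hwa : a ≤ ∑ e, w e) (N : ℕ) : ∀ (R S : Finset E) (B : Finset E → ℝ), R.card = N → R ⊆ X →
    (S.card : ℝ) ≤ τ * X.card + 1 → Bounded X s (2 * κ * τ) τ B →
    S.card * (a / (2 * X.card)) ≤ ∑ e, B e →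
    ∃ t : QueryTree E (Finset E ⊕ (Finset E → ℝ)), ∀ I, WIndep w I → WIndep B I → S ⊆ I →
      I ⊆ S ∪ R →
      (((S ∪ t.yes I).card : ℝ) ≤ τ * X.card + 1) ∧
      (∀ C, t.out I = .inl C → I ⊆ S ∪ t.yes I ∪ C ∧ C ⊆ X ∧
        (C.card : ℝ) ≤ X.card - a / (4 * κ)) ∧
      (∀ B', t.out I = .inr B' → WIndep B' I ∧ Bounded X s (2 * κ * τ) τ B' ∧
        a * τ / 2 ^ (s + 2) ≤ ∑ e, B' e) := by
  have hm : (0 : ℝ) < X.card := by exact_mod_cast hX.card_pos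
  induction N with
  | zero =>
    intro R S B hR hRX hS hB hBS
    refine ⟨.leaf (.inl ∅), fun I _ _ _ hI => ⟨by simpa [QueryTree.yes] using hS, ?_, ?_⟩⟩
    · rintro C hC
      simp only [QueryTree.out, Sum.inl.injEq] at hC
      subst hC
      rw [Finset.card_eq_zero] at hR
      subst hR
      refine ⟨by simpa [QueryTree.yes] using hI, by simp, ?_⟩
      -- With `B = 0` and no vertex remaining, the loss bound reads a ≤ κ|X|, so the empty container
      -- meets the size requirement.
      have h1 := sum_sub_unsaturated_le (B := fun _ => 0) hτ hw (by simp) (by simp) ∅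
      have h2 : ∑ e, unsaturated w (fun _ => 0) κ τ ∅ e = 0 := by
        refine Finset.sum_eq_zero fun e _ => ?_
        by_contra hne
        have := of_unsaturated_ne_zero hne
        have h3 := hw.card e this.1
        rw [Finset.subset_empty.1 this.2.1] at h3
        simp at h3
      rw [h2] at h1
      simp only [Finset.sdiff_empty, Finset.sum_const_zero, mul_zero, zero_div, add_zero,
        zero_add] at h1
      have : a / (4 * κ) ≤ X.card := by
        rw [div_le_iff₀ (by positivity)]; nlinarith
      simpa using this
    · intro B' hB'; simp [QueryTree.out] at hB'
  | succ N ih =>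
    intro R S B hR hRX hS hB hBS
    -- First stopping rule: enough positive answers. Each contributed at least a/(2|X|) to `B`, so
    -- `B` is heavy. Until then |S| < τ|X|, whence the bound τ|X| + 1.
    by_cases c1 : τ * X.card ≤ S.card
    · refine ⟨.leaf (.inr B), fun I _ hBI _ hI => ⟨by simpa [QueryTree.yes] using hS, ?_, ?_⟩⟩
      · intro C hC; simp [QueryTree.out] at hC
      · intro B' hB'
        simp only [QueryTree.out, Sum.inr.injEq] at hB'
        subst hB'
        refine ⟨hBI, hB, le_trans ?_ hBS⟩
        calc a * τ / 2 ^ (s + 2) ≤ a * τ / 2 := by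
              gcongr
              calc (2 : ℝ) = 2 ^ 1 := by norm_num
                _ ≤ 2 ^ (s + 2) := pow_le_pow_right₀ (by norm_num) (by omega)
          _ = τ * X.card * (a / (2 * X.card)) := by field_simp
          _ ≤ _ := by gcongr
    -- Second stopping rule: so many vertices were discarded that `R` itself is the container.
    by_cases c2 : (R.card : ℝ) ≤ X.card - a / (4 * κ)
    · refine ⟨.leaf (.inl R), fun I _ _ _ hI => ⟨by simpa [QueryTree.yes] using hS, ?_, ?_⟩⟩
      · intro C hC
        simp only [QueryTree.out, Sum.inl.injEq] at hC
        subst hC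
        exact ⟨by simpa [QueryTree.yes] using hI, hRX, c2⟩
      · intro B' hB'; simp [QueryTree.out] at hB'
    -- Third stopping rule: over half of `a` is lost. Discarded vertices account for at most a/4, so
    -- saturation accounts for at least a/4, which forces `B` to be heavy.
    by_cases c3 : ∑ e, unsaturated w B κ τ R e < a / 2
    · refine ⟨.leaf (.inr B), fun I _ hBI _ hI => ⟨by simpa [QueryTree.yes] using hS, ?_, ?_⟩⟩
      · intro C hC; simp [QueryTree.out] at hC
      · intro B' hB'
        simp only [QueryTree.out, Sum.inr.injEq] at hB'
        subst hB'
        refine ⟨hBI, hB, ?_⟩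
        have h1 := sum_sub_unsaturated_le hτ hw hB.nonneg hB.card R
        have h2 : ((X \ R).card : ℝ) * κ ≤ a / 4 := by
          rw [Finset.cast_card_sdiff hRX]
          push Not at c2
          have : (X.card : ℝ) - R.card ≤ a / (4 * κ) := by linarith
          calc _ ≤ a / (4 * κ) * κ := by gcongr
            _ = a / 4 := by field_simp
        have h3 : a / 4 ≤ 2 ^ s * (∑ e, B e) / τ := by linarith
        rw [le_div_iff₀ hτ] at h3
        rw [div_le_iff₀ (by positivity), pow_add]
        linarith
    push Not at c1 c3
    set A := unsaturated w B κ τ R with hA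
    have hAn : ∀ e, 0 ≤ A e := unsaturated_nonneg hw.nonneg
    -- Otherwise query a vertex of at least average degree among the unsaturated edges. A positive
    -- answer adds its link to `B`; a negative one only removes it from `R`.
    obtain ⟨v, hvR, hv⟩ := exists_le_card_mul_wdeg (w := A) (R := R) hAn (fun e he => by
      have := of_unsaturated_ne_zero he
      refine ⟨this.2.1, Finset.card_pos.1 ?_⟩
      rw [hw.card e this.1]; omega) (by linarith)
    set B₁ : Finset E → ℝ := fun e => B e + wlink A v e with hB₁
    have hB₁b : Bounded X s (2 * κ * τ) τ B₁ := Bounded.add_wlink hw hB v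
    have hRc : (R.erase v).card = N := by rw [Finset.card_erase_of_mem hvR, hR]; rfl
    have hRX' : R.erase v ⊆ X := (Finset.erase_subset v R).trans hRX
    have hScard : ((insert v S).card : ℝ) ≤ S.card + 1 := by
      exact_mod_cast Finset.card_insert_le v S
    have hA1 : a / (2 * X.card) ≤ wdeg A {v} := by
      rw [div_le_iff₀ (by positivity)]
      have : (R.card : ℝ) ≤ X.card := by exact_mod_cast Finset.card_le_card hRX
      have := mul_le_mul_of_nonneg_right this (wdeg_nonneg hAn {v})
      linarith
    have hsum : ∑ e, B₁ e = ∑ e, B e + wdeg A {v} := by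
      have := wdeg_wlink A v ∅
      rw [wdeg_empty] at this
      simp only [hB₁, Finset.sum_add_distrib, this]
      simp
    obtain ⟨ty, hty⟩ := ih (R.erase v) (insert v S) B₁ hRc hRX' (by linarith) hB₁b (by
      rw [hsum]
      have : ((insert v S).card : ℝ) * (a / (2 * X.card)) ≤ (S.card + 1) * (a / (2 * X.card)) := by
        gcongr
      linarith)
    obtain ⟨tn, htn⟩ := ih (R.erase v) S B hRc hRX' hS hB hBS
    refine ⟨.node v ty tn, fun I hwI hBI hSI hI => ?_⟩
    by_cases hvI : v ∈ I
    · have hB₁I : WIndep B₁ I := by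
        intro e he
        simp only [hB₁, hBI e he, zero_add, wlink]
        split_ifs
        · rfl
        · have h0 := hwI (insert v e) (Finset.insert_subset hvI he)
          have h1 := unsaturated_le (B := B) (κ := κ) (τ := τ) (R := R) hw.nonneg (insert v e)
          exact le_antisymm (h1.trans h0.le) (hAn _)
      have := hty I hwI hB₁I (Finset.insert_subset hvI hSI) (by
        refine hI.trans ?_
        intro x hx
        simp only [Finset.mem_union, Finset.mem_insert, Finset.mem_erase] at hx ⊢
        tauto)
      have e1 : insert v S ∪ ty.yes I = S ∪ insert v (ty.yes I) := by
        ext x; simp only [Finset.mem_union, Finset.mem_insert]; tauto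
      simp only [QueryTree.yes, QueryTree.out, if_pos hvI]
      rw [e1] at this
      exact this
    · have := htn I hwI hBI hSI (by
        intro x hx
        have := hI hx
        simp only [Finset.mem_union, Finset.mem_erase] at this ⊢
        rcases this with h | h
        · exact .inl h
        · exact .inr ⟨fun h' => hvI (h' ▸ hx), h⟩)
      simp only [QueryTree.yes, QueryTree.out, if_neg hvI]
      exact this

end Stage

/-- The container lemma for uniform hypergraphs with bounded degrees. -/
theorem exists_container_tree (s : ℕ) (hs : 1 ≤ s) : ∀ ρ : ℝ, 0 < ρ → ∃ δ : ℝ, 0 < δ ∧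
    ∀ (E : Type) [Fintype E] [DecidableEq E] (X : Finset E) (κ τ : ℝ) (w : Finset E → ℝ),
    0 < κ → 0 < τ → X.Nonempty → Bounded X s κ τ w → ρ * κ * X.card ≤ ∑ e, w e →
    ∃ t : QueryTree E (Finset E), ∀ I, WIndep w I → I ⊆ X →
      ((t.yes I).card : ℝ) ≤ s * (τ * X.card + 1) ∧ I ⊆ t.yes I ∪ t.out I ∧ t.out I ⊆ X ∧
      ((t.out I).card : ℝ) ≤ (1 - δ) * X.card := by
  induction s, hs using Nat.le_induction with
  | base =>
    intro ρ hρ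
    refine ⟨ρ, hρ, ?_⟩
    intro E _ _ X κ τ w hκ hτ hX hw hwa
    classical
    -- In the 1-uniform case, independent sets avoid every vertex of positive weight, so no query is
    -- needed.
    refine ⟨.leaf (X.filter fun v => w {v} = 0), fun I hI hIX => ?_⟩
    refine ⟨by simp [QueryTree.yes]; positivity, ?_, by simp [QueryTree.out], ?_⟩
    · intro v hv
      simp only [QueryTree.yes, QueryTree.out, Finset.empty_union, Finset.mem_filter]
      exact ⟨hIX hv, hI {v} (by simpa using hv)⟩
    · simp only [QueryTree.out]
      have h1 := Finset.card_filter_add_card_filter_not (s := X) (fun v => w {v} = 0)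
      have h2 : ∑ e, w e ≤ (X.filter fun v => ¬ w {v} = 0).card * κ := by
        have : ∑ e, w e ≤ ∑ e, ((X.filter fun v => ¬ w {v} = 0) ∩ e).card * w e := by
          refine Finset.sum_le_sum fun e _ => ?_
          by_cases he : w e = 0
          · simp [he]
          · obtain ⟨v, rfl⟩ := Finset.card_eq_one.1 (hw.card e he)
            have : v ∈ X := hw.subset _ he (by simp)
            rw [Finset.inter_singleton_of_mem (by simp [this, he])]
            simp
        refine this.trans ?_
        rw [← sum_wdeg_singleton]
        refine (Finset.sum_le_card_nsmul _ _ κ fun v _ => ?_).trans (by rw [nsmul_eq_mul])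
        simpa using hw.deg {v} (Finset.singleton_nonempty v)
      have h3 : ρ * X.card ≤ (X.filter fun v => ¬ w {v} = 0).card := by
        have : ρ * X.card * κ ≤ (X.filter fun v => ¬ w {v} = 0).card * κ := by linarith
        exact le_of_mul_le_mul_right this hκ
      have h1' : ((X.filter fun v => w {v} = 0).card : ℝ) +
        (X.filter fun v => ¬ w {v} = 0).card = X.card := by exact_mod_cast h1
      linarith
  | succ s hs ih =>
    intro ρ hρ
    -- The density passed on satisfies ρ κ |X| τ / 2^(s+2) = (ρ / 2^(s+3)) (2κτ) |X|, since 2κτ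
    -- replaces κ in the `s`-uniform hypergraph.
    obtain ⟨δ, hδ, H⟩ := ih (ρ / 2 ^ (s + 3)) (by positivity)
    refine ⟨min δ (ρ / 4), by positivity, ?_⟩
    intro E _ _ X κ τ w hκ hτ hX hw hwa
    have hm : (0 : ℝ) < X.card := by exact_mod_cast hX.card_pos
    obtain ⟨t, ht⟩ := exists_tree_of_state (a := ρ * κ * X.card) hκ hτ (by positivity) hw hX hwa _
      X ∅ (fun _ => 0) rfl subset_rfl (by simp; positivity)
      ⟨by simp, by simp, by simp, by intro σ _; simp [wdeg]; positivity⟩ (by simp)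
    -- A tree is attached to every possible label `B`; labels violating the bounds are never reached
    -- and get a default leaf.
    have key : ∀ B : Finset E → ℝ, ∃ t' : QueryTree E (Finset E),
        Bounded X s (2 * κ * τ) τ B ∧ ρ * κ * X.card * τ / 2 ^ (s + 2) ≤ ∑ e, B e →
        ∀ I, WIndep B I → I ⊆ X →
        ((t'.yes I).card : ℝ) ≤ s * (τ * X.card + 1) ∧ I ⊆ t'.yes I ∪ t'.out I ∧ t'.out I ⊆ X ∧
        ((t'.out I).card : ℝ) ≤ (1 - δ) * X.card := by
      intro B
      by_cases hB : Bounded X s (2 * κ * τ) τ B ∧ ρ * κ * X.card * τ / 2 ^ (s + 2) ≤ ∑ e, B e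
      · obtain ⟨t', ht'⟩ := H E X (2 * κ * τ) τ B (by positivity) hτ hX hB.1 (by
          refine le_trans (le_of_eq ?_) hB.2
          rw [pow_succ 2 (s + 2)]
          field_simp)
        exact ⟨t', fun _ => ht'⟩
      · exact ⟨.leaf ∅, fun h => absurd h hB⟩
    choose T hT using key
    refine ⟨t.bind (Sum.elim (fun C => .leaf C) T), fun I hI hIX => ?_⟩
    obtain ⟨h1, h2, h3⟩ := ht I hI (fun _ _ => rfl) (by simp) (by simpa using hIX)
    rw [QueryTree.out_bind, QueryTree.yes_bind]
    simp only [Finset.empty_union] at h1 h2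
    have hτm : 0 ≤ τ * X.card + 1 := by positivity
    cases hout : t.out I with
    | inl C =>
      obtain ⟨h4, h5, h6⟩ := h2 C hout
      simp only [Sum.elim_inl, QueryTree.yes, QueryTree.out, Finset.union_empty]
      refine ⟨?_, h4, h5, ?_⟩
      · refine h1.trans ?_
        push_cast
        nlinarith [mul_nonneg (Nat.cast_nonneg (α := ℝ) s) hτm]
      · refine h6.trans ?_
        have : min δ (ρ / 4) ≤ ρ / 4 := min_le_right _ _
        have h7 : ρ * κ * X.card / (4 * κ) = ρ / 4 * X.card := by field_simp
        rw [h7]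
        nlinarith
    | inr B =>
      obtain ⟨h4, h5, h6⟩ := h3 B hout
      obtain ⟨g1, g2, g3, g4⟩ := hT B ⟨h5, h6⟩ I h4 hIX
      simp only [Sum.elim_inr]
      refine ⟨?_, ?_, g3, ?_⟩
      · have : (((t.yes I ∪ (T B).yes I).card : ℕ) : ℝ) ≤ (t.yes I).card + ((T B).yes I).card := by
          exact_mod_cast Finset.card_union_le _ _
        push_cast
        linarith
      · intro x hx
        have := g2 hx
        simp only [Finset.mem_union] at this ⊢
        tauto
      · have : min δ (ρ / 4) ≤ δ := min_le_left _ _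
        nlinarith

/-! ### Random vertex subsets of fixed size -/

section Sampling

theorem card_filter_superset {n u : ℕ} (A : Finset (Fin n)) (hA : A.card ≤ u) :
    ((Finset.powersetCard u (Finset.univ : Finset (Fin n))).filter (A ⊆ ·)).card =
      (n - A.card).choose (u - A.card) := by
  have : (n - A.card) = (Aᶜ).card := by rw [Finset.card_compl, Fintype.card_fin]
  rw [this, ← Finset.card_powersetCard]
  refine Finset.card_bij' (fun U _ => U \ A) (fun U _ => U ∪ A) ?_ ?_ ?_ ?_
  · intro U hU
    simp only [Finset.mem_filter, Finset.mem_powersetCard, Finset.subset_univ, true_and] at hU ⊢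
    refine ⟨fun x hx => by simp at hx ⊢; exact hx.2, ?_⟩
    rw [Finset.card_sdiff_of_subset hU.2, hU.1]
  · intro U hU
    simp only [Finset.mem_filter, Finset.mem_powersetCard, Finset.subset_univ, true_and] at hU ⊢
    refine ⟨?_, Finset.subset_union_right⟩
    rw [Finset.card_union_of_disjoint, hU.2]
    · omega
    · rw [Finset.disjoint_left]
      intro x hx; simpa using hU.1 hx
  · intro U hU
    simp only [Finset.mem_filter] at hU
    exact Finset.sdiff_union_of_subset hU.2
  · intro U hU
    simp only [Finset.mem_powersetCard] at hU
    refine Finset.union_sdiff_cancel_right ?_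
    rw [Finset.disjoint_left]
    intro x hx; simpa using hU.1 hx

/-- The probability that a random `u`-subset contains `a` given points is a product of factors
(u-i)/(n-i) ≤ u/n; denominators are cleared here. -/
theorem choose_sub_mul_pow_le {n u : ℕ} (hun : u ≤ n) (a : ℕ) (ha : a ≤ u) :
    (n - a).choose (u - a) * n ^ a ≤ n.choose u * u ^ a := by
  induction a with
  | zero => simp
  | succ a ih =>
    have ih := ih (by omega)
    obtain ⟨p, hp⟩ : ∃ p, n - a = p + 1 := ⟨n - a - 1, by omega⟩
    obtain ⟨q, hq⟩ : ∃ q, u - a = q + 1 := ⟨u - a - 1, by omega⟩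
    have e1 : n - (a + 1) = p := by omega
    have e2 : u - (a + 1) = q := by omega
    rw [hp, hq] at ih
    rw [e1, e2]
    have h1 := Nat.add_one_mul_choose_eq p q
    have h2 : (q + 1) * n ≤ (p + 1) * u := by
      obtain ⟨z, rfl⟩ : ∃ z, n = u + z := ⟨n - u, by omega⟩
      have : u = q + 1 + a := by omega
      have : p = q + z := by omega
      subst this
      subst u
      nlinarith
    have h3 : (p + 1) * (p.choose q * n ^ (a + 1)) ≤ (p + 1) * (n.choose u * u ^ (a + 1)) := by
      calc (p + 1) * (p.choose q * n ^ (a + 1)) = ((p + 1) * p.choose q) * n ^ a * n := by ring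
        _ = ((p + 1).choose (q + 1) * n ^ a) * ((q + 1) * n) := by rw [h1]; ring
        _ ≤ (n.choose u * u ^ a) * ((p + 1) * u) := Nat.mul_le_mul ih h2
        _ = _ := by ring
    exact Nat.le_of_mul_le_mul_left h3 (by omega)

theorem card_filter_superset_le {n u : ℕ} (hn : 0 < n) (hun : u ≤ n) (A : Finset (Fin n)) :
    (((Finset.powersetCard u (Finset.univ : Finset (Fin n))).filter (A ⊆ ·)).card : ℝ) ≤
      n.choose u * (u / n : ℝ) ^ A.card := by
  by_cases hA : A.card ≤ u
  · rw [card_filter_superset A hA, div_pow, ← mul_div_assoc, le_div_iff₀ (by positivity)]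
    exact_mod_cast choose_sub_mul_pow_le hun _ hA
  · have : (Finset.powersetCard u (Finset.univ : Finset (Fin n))).filter (A ⊆ ·) = ∅ := by
      refine Finset.filter_eq_empty_iff.2 fun U hU h => hA ?_
      rw [Finset.mem_powersetCard] at hU
      exact hU.2 ▸ Finset.card_le_card h
    rw [this]; simp; positivity

/-- The exact probability is u(u-1)/(n(n-1)), and u-1 ≥ u/2 for u ≥ 2. -/
theorem le_card_filter_superset_of_card_two {n u : ℕ} (hu : 2 ≤ u) (hun : u ≤ n)
    (A : Finset (Fin n)) (hA : A.card = 2) :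
    n.choose u * ((u / n : ℝ) ^ 2 / 2) ≤
      ((Finset.powersetCard u (Finset.univ : Finset (Fin n))).filter (A ⊆ ·)).card := by
  rw [card_filter_superset A (by omega), hA]
  obtain ⟨p, rfl⟩ : ∃ p, n = p + 2 := ⟨n - 2, by omega⟩
  obtain ⟨q, rfl⟩ : ∃ q, u = q + 2 := ⟨u - 2, by omega⟩
  simp only [Nat.add_sub_cancel]
  have h1 := Nat.add_one_mul_choose_eq (p + 1) (q + 1)
  have h2 := Nat.add_one_mul_choose_eq p q
  have h3 : ((p : ℝ) + 2) * (p + 1) * p.choose q = (p + 2).choose (q + 2) * (q + 2) * (q + 1) := by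
    have : (p + 2) * (p + 1) * p.choose q = (p + 2).choose (q + 2) * (q + 2) * (q + 1) := by
      calc _ = (p + 2) * ((p + 1) * p.choose q) := by ring
        _ = (p + 1 + 1) * ((p + 1).choose (q + 1)) * (q + 1) := by rw [h2]; ring
        _ = _ := by rw [h1]
    exact_mod_cast this
  push_cast
  rw [div_pow, div_div, ← mul_div_assoc, div_le_iff₀ (by positivity)]
  have hC : (0 : ℝ) ≤ (p + 2).choose (q + 2) := by positivity
  have hc : (0 : ℝ) ≤ p.choose q := by positivity
  have hq : (0 : ℝ) ≤ q := by positivity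
  have hp : (0 : ℝ) ≤ p := by positivity
  have hCq := mul_nonneg hC hq
  have hCqq := mul_nonneg hCq hq
  have hcp := mul_nonneg hc hp
  calc ((p + 2).choose (q + 2) : ℝ) * (q + 2) ^ 2
      ≤ 2 * ((p + 2).choose (q + 2) * (q + 2) * (q + 1)) := by nlinarith
    _ = 2 * ((p + 2) * (p + 1) * p.choose q) := by rw [h3]
    _ ≤ _ := by nlinarith

theorem sum_card_filter_subset_swap {ι W : Type*} [DecidableEq W] (P : Finset (Finset W))
    (Y : Finset ι) (d : ι → Finset W) :
    ∑ U ∈ P, ((Y.filter (d · ⊆ U)).card : ℝ) = ∑ i ∈ Y, ((P.filter (d i ⊆ ·)).card : ℝ) := by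
  simp only [Finset.card_filter, Nat.cast_sum]
  exact Finset.sum_comm

/-- A uniformly random `u`-subset realizes the expectation of a linear statistic. -/
theorem exists_subset_of_average {ι₁ ι₂ ι₃ : Type*} {n u : ℕ} (hu : 2 ≤ u) (hun : u ≤ n)
    (X : Finset ι₁) (a : ι₁ → Finset (Fin n)) (ha : ∀ i ∈ X, (a i).card = 2)
    (S : Finset ι₂) (b : ι₂ → Finset (Fin n))
    (F : Finset ι₃) (c : ι₃ → Finset (Fin n)) (h : ℕ) (hc : ∀ i ∈ F, (c i).card = h)
    (β : ℝ) (hβ : 0 ≤ β) :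
    ∃ U : Finset (Fin n), U.card = u ∧
      X.card * ((u / n : ℝ) ^ 2 / 2) - ∑ i ∈ S, (u / n : ℝ) ^ (b i).card -
          β * (F.card * (u / n : ℝ) ^ h) ≤
        (X.filter (a · ⊆ U)).card - (S.filter (b · ⊆ U)).card - β * (F.filter (c · ⊆ U)).card := by
  set P := Finset.powersetCard u (Finset.univ : Finset (Fin n)) with hP
  have hPc : (P.card : ℝ) = n.choose u := by simp [hP, Finset.card_powersetCard]
  have hPne : P.Nonempty := by
    rw [← Finset.card_pos, hP, Finset.card_powersetCard]
    simpa using Nat.choose_pos hun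
  have hn : 0 < n := by omega
  obtain ⟨U, hU, hle⟩ := Finset.exists_le_of_sum_le (s := P) (f := fun _ =>
      X.card * ((u / n : ℝ) ^ 2 / 2) - ∑ i ∈ S, (u / n : ℝ) ^ (b i).card -
          β * (F.card * (u / n : ℝ) ^ h))
      (g := fun U => (X.filter (a · ⊆ U)).card - (S.filter (b · ⊆ U)).card -
        β * (F.filter (c · ⊆ U)).card) hPne (by
    rw [Finset.sum_const, nsmul_eq_mul, hPc, Finset.sum_sub_distrib, Finset.sum_sub_distrib,
      ← Finset.mul_sum, sum_card_filter_subset_swap P X a,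
      sum_card_filter_subset_swap P S b, sum_card_filter_subset_swap P F c]
    have h1 : X.card * (n.choose u * ((u / n : ℝ) ^ 2 / 2)) ≤
        ∑ i ∈ X, ((P.filter (a i ⊆ ·)).card : ℝ) := by
      rw [← nsmul_eq_mul]
      exact Finset.card_nsmul_le_sum _ _ _ fun i hi =>
        le_card_filter_superset_of_card_two hu hun _ (ha i hi)
    have h2 : ∑ i ∈ S, ((P.filter (b i ⊆ ·)).card : ℝ) ≤
        n.choose u * ∑ i ∈ S, (u / n : ℝ) ^ (b i).card := by
      rw [Finset.mul_sum]
      exact Finset.sum_le_sum fun i _ => card_filter_superset_le hn hun _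
    have h3 : ∑ i ∈ F, ((P.filter (c i ⊆ ·)).card : ℝ) ≤
        F.card * (n.choose u * (u / n : ℝ) ^ h) := by
      rw [← nsmul_eq_mul]
      exact Finset.sum_le_card_nsmul _ _ _ fun i hi =>
        hc i hi ▸ card_filter_superset_le hn hun _
    have h4 := mul_le_mul_of_nonneg_left h3 hβ
    linarith)
  exact ⟨U, (Finset.mem_powersetCard.1 hU).2, hle⟩

end Sampling

/-! ### Copies of `H` and balanced supersaturation -/

section Copies

variable {V W : Type*} [Finite V]

/-- The set of edges of the image of `H` under the map `f`. -/
noncomputable def copyEdges (H : SimpleGraph V) (f : V → W) : Finset (Sym2 W) :=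
  (Set.toFinite (Sym2.map f '' H.edgeSet)).toFinset

theorem mem_copyEdges {H : SimpleGraph V} {f : V → W} {e : Sym2 W} :
    e ∈ copyEdges H f ↔ ∃ e' ∈ H.edgeSet, Sym2.map f e' = e := by
  simp [copyEdges]

theorem card_copyEdges (H : SimpleGraph V) {f : V → W} (hf : f.Injective) :
    (copyEdges H f).card = H.edgeSet.ncard := by
  rw [copyEdges, ← Set.ncard_eq_toFinset_card (Sym2.map f '' H.edgeSet) (Set.toFinite _),
    Set.ncard_image_of_injective _ (Sym2.map.injective hf)]

variable [DecidableEq W]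

/-- The set of vertices covered by a set of edges. -/
def cover (σ : Finset (Sym2 W)) : Finset W := σ.biUnion Sym2.toFinset

theorem mem_cover {σ : Finset (Sym2 W)} {x : W} : x ∈ cover σ ↔ ∃ e ∈ σ, x ∈ e := by
  simp [cover]

theorem cover_subset_iff {σ : Finset (Sym2 W)} {U : Finset W} :
    cover σ ⊆ U ↔ ∀ e ∈ σ, e.toFinset ⊆ U := Finset.biUnion_subset

/-- A proper part of a copy of `H` has density at most `μ`. -/
theorem card_sub_one_le_of_subset_copyEdges {H : SimpleGraph V} {μ : ℝ}
    (hμ : ∀ F : H.Subgraph, F ≠ ⊤ → 2 < F.verts.ncard →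
      (F.edgeSet.ncard : ℝ) - 1 ≤ μ * ((F.verts.ncard : ℝ) - 2))
    {f : V → W} (hf : f.Injective) {σ : Finset (Sym2 W)} (hσ : σ.Nonempty)
    (hσf : σ ⊆ copyEdges H f)
    (hfull : (cover σ).card ≠ Nat.card V) :
    2 ≤ (cover σ).card ∧ (cover σ).card ≤ Nat.card V ∧
      (σ.card : ℝ) - 1 ≤ μ * ((cover σ).card - 2) := by
  classical
  have hdiag : ∀ e ∈ σ, ¬ e.IsDiag := by
    intro e he
    obtain ⟨e', he', rfl⟩ := mem_copyEdges.1 (hσf he)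
    rw [Sym2.isDiag_map hf]
    exact H.not_isDiag_of_mem_edgeSet he'
  have hcov : ∀ x ∈ cover σ, ∃ v, f v = x := by
    intro x hx
    obtain ⟨e, he, hxe⟩ := mem_cover.1 hx
    obtain ⟨e', he', rfl⟩ := mem_copyEdges.1 (hσf he)
    obtain ⟨v, -, hv⟩ := Sym2.mem_map.1 hxe
    exact ⟨v, hv⟩
  -- Pull `σ` back along `f` to a subgraph of `H` with the same numbers of edges and vertices. It is
  -- proper because `σ` does not cover all vertices of the copy.
  let F : H.Subgraph :=
    { verts := {v | f v ∈ cover σ}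
      Adj := fun a b => H.Adj a b ∧ s(f a, f b) ∈ σ
      adj_sub := fun h => h.1
      edge_vert := fun h => mem_cover.2 ⟨_, h.2, Sym2.mem_mk_left _ _⟩
      symm := ⟨fun a b h => ⟨h.1.symm, by rw [Sym2.eq_swap]; exact h.2⟩⟩ }
  have hFe : F.edgeSet.ncard = σ.card := by
    have : Sym2.map f '' F.edgeSet = (σ : Set (Sym2 W)) := by
      ext e
      constructor
      · rintro ⟨e', he', rfl⟩
        induction e' with
        | _ a b => exact (SimpleGraph.Subgraph.mem_edgeSet.1 he').2
      · intro he
        obtain ⟨e', he', rfl⟩ := mem_copyEdges.1 (hσf he)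
        refine ⟨e', ?_, rfl⟩
        induction e' with
        | _ a b => exact SimpleGraph.Subgraph.mem_edgeSet.2 ⟨he', he⟩
    rw [← Set.ncard_coe_finset, ← this, Set.ncard_image_of_injective _ (Sym2.map.injective hf)]
  have hFv : F.verts.ncard = (cover σ).card := by
    have : f '' F.verts = (cover σ : Set W) := by
      ext x
      constructor
      · rintro ⟨v, hv, rfl⟩; exact hv
      · intro hx
        obtain ⟨v, rfl⟩ := hcov x hx
        exact ⟨v, hx, rfl⟩
    rw [← Set.ncard_coe_finset, ← this, Set.ncard_image_of_injective _ hf]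
  obtain ⟨e, he⟩ := hσ
  have hesub : e.toFinset ⊆ cover σ := cover_subset_iff.1 subset_rfl e he
  have h2 : 2 ≤ (cover σ).card := by
    rw [← Sym2.card_toFinset_of_not_isDiag e (hdiag e he)]
    exact Finset.card_le_card hesub
  refine ⟨h2, ?_, ?_⟩
  · rw [← hFv, ← Set.ncard_univ]; exact Set.ncard_le_ncard (Set.subset_univ _)
  rcases h2.lt_or_eq with h2 | h2
  · rw [← hFe, ← hFv]
    refine hμ F ?_ (hFv ▸ h2)
    rintro hF
    exact hfull (by rw [← hFv, hF, SimpleGraph.Subgraph.verts_top, Set.ncard_univ])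
  -- On two vertices `m*₂` says nothing, but then `σ` is a single edge and both sides vanish.
  · have : σ = {e} := by
      refine Finset.eq_singleton_iff_unique_mem.2 ⟨he, fun e' he' => ?_⟩
      have key : ∀ e ∈ σ, e.toFinset = cover σ := fun e he =>
        Finset.eq_of_subset_of_card_le (cover_subset_iff.1 subset_rfl e he)
          (by rw [Sym2.card_toFinset_of_not_isDiag e (hdiag e he), h2])
      refine Sym2.ext fun x => ?_
      rw [← Sym2.mem_toFinset, ← Sym2.mem_toFinset, key e he, key e' he']
    rw [← h2, this]
    simp

/-- Few maps have a given full image. -/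
theorem card_filter_full_le {H : SimpleGraph V}
    (𝓕 : Finset (V → W)) (h𝓕 : ∀ f ∈ 𝓕, f.Injective) {σ : Finset (Sym2 W)}
    (h2 : (cover σ).card = Nat.card V) :
    (𝓕.filter fun f => σ ⊆ copyEdges H f).card ≤ Nat.card V ^ Nat.card V := by
  classical
  have := Fintype.ofFinite V
  have hsub : (𝓕.filter fun f => σ ⊆ copyEdges H f) ⊆
      Fintype.piFinset (fun _ : V => cover σ) := by
    intro f hf
    rw [Finset.mem_filter] at hf
    rw [Fintype.mem_piFinset]
    have hi := h𝓕 f hf.1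
    have hle : cover σ ⊆ Finset.univ.image f := by
      intro x hx
      obtain ⟨e, he, hxe⟩ := mem_cover.1 hx
      obtain ⟨e', he', rfl⟩ := mem_copyEdges.1 (hf.2 he)
      obtain ⟨v, -, hv⟩ := Sym2.mem_map.1 hxe
      exact Finset.mem_image.2 ⟨v, Finset.mem_univ _, hv⟩
    -- As `cover σ` is the whole image of `f`, every such `f` is one of the h^h maps from `V` to
    -- `cover σ`.
    have heq := Finset.eq_of_subset_of_card_le hle (by
      rw [h2, Finset.card_image_of_injective _ hi, Finset.card_univ, Nat.card_eq_fintype_card])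
    intro v
    rw [heq]
    exact Finset.mem_image_of_mem _ (Finset.mem_univ v)
  refine (Finset.card_le_card hsub).trans ?_
  simp [Fintype.card_piFinset, h2, Nat.card_eq_fintype_card]

end Copies

theorem labelledCopyCount_eq_natCard {V W : Type*} [Fintype V] [Fintype W] (G : SimpleGraph W)
    (H : SimpleGraph V) : G.labelledCopyCount H = Nat.card (H.Copy G) := by
  classical
  unfold SimpleGraph.labelledCopyCount
  exact Nat.card_eq_fintype_card.symm

/-- Supersaturation inside a vertex set provides a copy of `H` that is new and avoids a given
collection of edge sets. -/
theorem exists_new_copy {V : Type*} [Fintype V] {H : SimpleGraph V}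
    {n u : ℕ} (hn : 0 < n) {c t : ℝ} (hc : 0 < c)
    (hg : ∀ G : SimpleGraph (Fin u), t < (G.edgeSet.ncard : ℝ) →
      c * (G.edgeSet.ncard : ℝ) ^ H.edgeSet.ncard ≤ (G.copyCount H : ℝ))
    (X : Finset (Sym2 (Fin n))) (hX : ∀ e ∈ X, ¬ e.IsDiag)
    (sat : Finset (Finset (Sym2 (Fin n)))) (hsat : ∀ σ ∈ sat, σ.Nonempty)
    (𝓕 : Finset (V → Fin n)) (U : Finset (Fin n)) (hU : U.card = u) (T : ℝ) (hT0 : 0 ≤ T)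
    (hT : T ≤ (X.filter (Sym2.toFinset · ⊆ U)).card - (sat.filter (cover · ⊆ U)).card)
    (htT : t < T)
    (h𝓕 : ((𝓕.filter fun f => Finset.univ.image f ⊆ U).card : ℝ) < c * T ^ H.edgeSet.ncard) :
    ∃ f : V → Fin n, f.Injective ∧ copyEdges H f ⊆ X ∧ f ∉ 𝓕 ∧
      ∀ σ ∈ sat, ¬ σ ⊆ copyEdges H f := by
  classical
  -- One edge is chosen from each set in `sat`; the loop at 0 is a default value outside `sat`.
  -- Deleting these edges inside `U` destroys every set of `sat` there at a cost of one edge each.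
  have : ∀ σ : Finset (Sym2 (Fin n)), ∃ e, σ ∈ sat → e ∈ σ := fun σ => by
    by_cases h : σ ∈ sat
    · obtain ⟨e, he⟩ := hsat σ h
      exact ⟨e, fun _ => he⟩
    · exact ⟨s(⟨0, hn⟩, ⟨0, hn⟩), fun h' => absurd h' h⟩
  choose pick hpick using this
  set D := (sat.filter (cover · ⊆ U)).image pick with hD
  set X' := (X.filter (Sym2.toFinset · ⊆ U)) \ D with hX'
  set g := U.orderEmbOfFin hU with hgdef
  have hgU : ∀ i, g i ∈ U := fun i => Finset.orderEmbOfFin_mem U hU i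
  have hgsurj : ∀ x ∈ U, ∃ i, g i = x := fun x hx => by
    have := Finset.range_orderEmbOfFin U hU
    have hx' : x ∈ Set.range (U.orderEmbOfFin hU) := by rw [this]; exact hx
    exact hx'
  set G : SimpleGraph (Fin u) := (SimpleGraph.fromEdgeSet (X' : Set (Sym2 (Fin n)))).comap g with hG
  have hGe : G.edgeSet.ncard = X'.card := by
    have : Sym2.map g '' G.edgeSet = (X' : Set (Sym2 (Fin n))) := by
      ext e
      constructor
      · rintro ⟨e', he', rfl⟩
        induction e' with
        | _ a b =>
          rw [SimpleGraph.mem_edgeSet, hG, SimpleGraph.comap_adj,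
            SimpleGraph.fromEdgeSet_adj] at he'
          exact he'.1
      · intro he
        have heX : e ∈ X ∧ e.toFinset ⊆ U := by
          have := (Finset.mem_sdiff.1 (Finset.mem_coe.1 he)).1
          simpa using this
        induction e with
        | _ a b =>
          obtain ⟨i, rfl⟩ := hgsurj a (heX.2 (by simp))
          obtain ⟨j, rfl⟩ := hgsurj b (heX.2 (by simp))
          refine ⟨s(i, j), ?_, rfl⟩
          rw [SimpleGraph.mem_edgeSet, hG, SimpleGraph.comap_adj, SimpleGraph.fromEdgeSet_adj]
          exact ⟨he, fun h => hX _ heX.1 (by simpa using h)⟩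
    rw [← Set.ncard_coe_finset, ← this,
      Set.ncard_image_of_injective _ (Sym2.map.injective g.injective)]
  have hTG : T ≤ (G.edgeSet.ncard : ℝ) := by
    rw [hGe]
    refine hT.trans ?_
    have h1 := Finset.le_card_sdiff D (X.filter (Sym2.toFinset · ⊆ U))
    have h2 : D.card ≤ (sat.filter (cover · ⊆ U)).card := Finset.card_image_le
    rw [← hX'] at h1
    have h3 : (X.filter (Sym2.toFinset · ⊆ U)).card ≤ X'.card +
      (sat.filter (cover · ⊆ U)).card := by omega
    have h3' : ((X.filter (Sym2.toFinset · ⊆ U)).card : ℝ) ≤ X'.card +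
      (sat.filter (cover · ⊆ U)).card := by exact_mod_cast h3
    linarith
  -- Goodness counts unlabelled copies, and labelled ones are at least as many. They outnumber the
  -- maps of `𝓕` into `U`, so one of them is new.
  have hcount : ((𝓕.filter fun f => Finset.univ.image f ⊆ U).card : ℝ) < (G.labelledCopyCount H : ℝ) := by
    refine h𝓕.trans_le (le_trans ?_ ((hg G (htT.trans_le hTG)).trans ?_))
    · gcongr
    · have := SimpleGraph.copyCount_le_labelledCopyCount (G := G) (H := H)
      exact_mod_cast this
  have hex : ∃ φ : H.Copy G, (fun v => g (φ v)) ∉ 𝓕 := by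
    by_contra hcon
    push Not at hcon
    have hle : G.labelledCopyCount H ≤ (𝓕.filter fun f => Finset.univ.image f ⊆ U).card := by
      rw [labelledCopyCount_eq_natCard]
      refine (Nat.card_le_card_of_injective (fun φ : H.Copy G =>
        (⟨fun v => g (φ v), Finset.mem_filter.2 ⟨hcon φ,
          Finset.image_subset_iff.2 fun v _ => hgU _⟩⟩ :
          {f // f ∈ 𝓕.filter fun f => Finset.univ.image f ⊆ U})) ?_).trans
          (Nat.card_eq_fintype_card.trans (Fintype.card_coe _)).le
      intro φ ψ h
      exact SimpleGraph.Copy.ext fun v => g.injective (congrFun (Subtype.ext_iff.1 h) v)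
    have : (G.labelledCopyCount H : ℝ) ≤ (𝓕.filter fun f => Finset.univ.image f ⊆ U).card := by
      exact_mod_cast hle
    linarith
  obtain ⟨φ, hφ⟩ := hex
  have hsubX' : copyEdges H (fun v => g (φ v)) ⊆ X' := by
    intro e he
    obtain ⟨e', he', rfl⟩ := mem_copyEdges.1 he
    induction e' with
    | _ a b =>
      have := φ.toHom.map_adj ((SimpleGraph.mem_edgeSet H).1 he')
      exact ((SimpleGraph.fromEdgeSet_adj _).1 (SimpleGraph.comap_adj.1 this)).1
  refine ⟨fun v => g (φ v), g.injective.comp φ.injective, ?_, hφ, ?_⟩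
  · exact hsubX'.trans (Finset.sdiff_subset.trans (Finset.filter_subset _ _))
  · intro σ hσ hσs
    have h1 : σ ⊆ X' := hσs.trans hsubX'
    have h2 : pick σ ∈ X' := h1 (hpick σ hσ)
    have h3 : cover σ ⊆ U := cover_subset_iff.2 fun e he => by
      have := (Finset.mem_sdiff.1 (h1 he)).1
      exact (Finset.mem_filter.1 this).2
    exact (Finset.mem_sdiff.1 h2).2 (Finset.mem_image_of_mem _ (Finset.mem_filter.2 ⟨hσ, h3⟩))

/-- The number of maps in `𝓕` whose image of `H` has edge set `e`. -/
noncomputable def copyWeight {V W : Type*} [Finite V] [DecidableEq W] (H : SimpleGraph V)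
    (𝓕 : Finset (V → W)) (e : Finset (Sym2 W)) : ℝ :=
  ((𝓕.filter fun f => copyEdges H f = e).card : ℝ)

section

variable {V W : Type*} [Finite V] [DecidableEq W] {H : SimpleGraph V}

theorem exists_of_copyWeight_ne_zero {𝓕 : Finset (V → W)} {e : Finset (Sym2 W)}
    (h : copyWeight H 𝓕 e ≠ 0) : ∃ f ∈ 𝓕, copyEdges H f = e := by
  unfold copyWeight at h
  obtain ⟨f, hf⟩ := Finset.card_ne_zero.1 (Nat.cast_ne_zero.1 h)
  rw [Finset.mem_filter] at hf
  exact ⟨f, hf⟩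

variable [Fintype W]

theorem wdeg_copyWeight (𝓕 : Finset (V → W)) (σ : Finset (Sym2 W)) :
    wdeg (copyWeight H 𝓕) σ = ((𝓕.filter fun f => σ ⊆ copyEdges H f).card : ℝ) := by
  unfold wdeg copyWeight
  rw [← Nat.cast_sum, Finset.card_eq_sum_card_fiberwise (f := copyEdges H)
    (t := Finset.univ.filter fun e => σ ⊆ e) (s := 𝓕.filter fun f => σ ⊆ copyEdges H f)]
  · congr 1
    refine Finset.sum_congr rfl fun e he => ?_
    rw [Finset.mem_filter] at he
    congr 1
    ext f
    simp only [Finset.mem_filter]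
    constructor
    · rintro ⟨h1, h2⟩; exact ⟨⟨h1, h2 ▸ he.2⟩, h2⟩
    · rintro ⟨⟨h1, _⟩, h2⟩; exact ⟨h1, h2⟩
  · intro f hf
    simpa using (Finset.mem_filter.1 hf).2

theorem sum_copyWeight (𝓕 : Finset (V → W)) : ∑ e, copyWeight H 𝓕 e = 𝓕.card := by
  rw [← wdeg_empty, wdeg_copyWeight]; simp

end

/-- Balanced supersaturation under abstract numerical assumptions. -/
theorem exists_bounded_copyWeight {V : Type*} [Fintype V] {H : SimpleGraph V} {μ : ℝ}
    (hμ : ∀ F : H.Subgraph, F ≠ ⊤ → 2 < F.verts.ncard →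
      (F.edgeSet.ncard : ℝ) - 1 ≤ μ * ((F.verts.ncard : ℝ) - 2))
    {n u : ℕ} (hu : 2 ≤ u) (hun : u ≤ n) {c t : ℝ} (hc : 0 < c)
    (hg : ∀ G : SimpleGraph (Fin u), t < (G.edgeSet.ncard : ℝ) →
      c * (G.edgeSet.ncard : ℝ) ^ H.edgeSet.ncard ≤ (G.copyCount H : ℝ))
    (X : Finset (Sym2 (Fin n))) (hX : ∀ e ∈ X, ¬ e.IsDiag) {κ τ M β C r : ℝ}
    (hr : r = u / n) (hκ : 0 < κ) (hτ : 0 < τ) (hτ1 : τ ≤ 1) (hβ : 0 < β) (hC : 0 ≤ C)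
    (h1 : 2 * ((Nat.card V : ℝ) ^ Nat.card V + 1) ≤ κ * τ ^ (H.edgeSet.ncard - 1))
    (h2 : ∀ v j : ℕ, 2 ≤ v → v ≤ Nat.card V → 1 ≤ j → (j : ℝ) - 1 ≤ μ * ((v : ℝ) - 2) →
      r ^ v ≤ C * r ^ 2 * τ ^ (j - 1))
    (h3 : 2 * C * 2 ^ H.edgeSet.ncard * M ≤ κ * (X.card / 8))
    (h4 : β * (M * r ^ Nat.card V) ≤ X.card * r ^ 2 / 8)
    (h5 : t < X.card * r ^ 2 / 4)
    (h6 : ∀ T : ℝ, X.card * r ^ 2 / 4 ≤ T → T ≤ β * (c * T ^ H.edgeSet.ncard))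
    (hXne : X.Nonempty) :
    ∃ w : Finset (Sym2 (Fin n)) → ℝ, Bounded X H.edgeSet.ncard κ τ w ∧ M ≤ ∑ e, w e ∧
      ∀ I : Finset (Sym2 (Fin n)), H.Free (SimpleGraph.fromEdgeSet (I : Set (Sym2 (Fin n)))) →
        WIndep w I := by
  classical
  have hn : 0 < n := by omega
  have hr0 : 0 < r := by rw [hr]; have : 0 < u := by omega
                         positivity
  set ℓ := H.edgeSet.ncard with hℓ
  set h := Nat.card V with hh
  let d : Finset (V → Fin n) → Finset (Sym2 (Fin n)) → ℕ :=
    fun 𝓕 σ => (𝓕.filter fun f => σ ⊆ copyEdges H f).card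
  let adm : Finset (V → Fin n) → Prop := fun 𝓕 =>
    (∀ f ∈ 𝓕, f.Injective ∧ copyEdges H f ⊆ X) ∧
      ∀ σ : Finset (Sym2 (Fin n)), σ.Nonempty → (d 𝓕 σ : ℝ) ≤ κ * τ ^ (σ.card - 1)
  have hadm0 : adm ∅ := ⟨by simp, fun σ _ => by simp [d]; positivity⟩
  -- Take a largest admissible family; if it has fewer than `M` members, a further copy can be
  -- added.
  obtain ⟨𝓕, h𝓕, hmax⟩ := Finset.exists_max_image (Finset.univ.filter adm) Finset.card
    ⟨∅, by simpa using hadm0⟩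
  simp only [Finset.mem_filter, Finset.mem_univ, true_and] at h𝓕 hmax
  have hcap : ∀ σ : Finset (Sym2 (Fin n)), ∀ f : V → Fin n, f.Injective → σ ⊆ copyEdges H f →
      2 * ((h : ℝ) ^ h + 1) ≤ κ * τ ^ (σ.card - 1) := by
    intro σ f hf hσ
    refine h1.trans ?_
    have : σ.card ≤ ℓ := (Finset.card_le_card hσ).trans (card_copyEdges H hf).le
    exact mul_le_mul_of_nonneg_left (pow_le_pow_of_le_one hτ.le hτ1 (by omega)) hκ.le
  have hM : M ≤ 𝓕.card := by
    by_contra hlt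
    push Not at hlt
    -- Saturation is declared at half the capacity. By `hcap` half the capacity is at least h^h + 1,
    -- so one more copy through an unsaturated set is harmless, and sets covering all `h` vertices
    -- are never saturated.
    set sat := Finset.univ.filter fun σ : Finset (Sym2 (Fin n)) =>
      σ.Nonempty ∧ κ * τ ^ (σ.card - 1) / 2 ≤ d 𝓕 σ with hsat
    have hsatbound : ∑ σ ∈ sat, r ^ (cover σ).card ≤ X.card * r ^ 2 / 8 := by
      have hterm : ∀ σ ∈ sat, r ^ (cover σ).card ≤ 2 * C * r ^ 2 / κ * d 𝓕 σ := by
        intro σ hσ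
        simp only [hsat, Finset.mem_filter, Finset.mem_univ, true_and] at hσ
        obtain ⟨hσne, hσd⟩ := hσ
        have hpos : (0 : ℝ) < d 𝓕 σ := lt_of_lt_of_le (by positivity) hσd
        obtain ⟨f, hf⟩ := Finset.card_pos.1 (Nat.cast_pos.1 hpos)
        rw [Finset.mem_filter] at hf
        have hfi := (h𝓕.1 f hf.1).1
        have hnf : (cover σ).card ≠ h := by
          intro hfull
          have h7 := card_filter_full_le (H := H) 𝓕 (fun f hf => (h𝓕.1 f hf).1) hfull
          have h8 : (d 𝓕 σ : ℝ) ≤ (h : ℝ) ^ h := by exact_mod_cast h7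
          have h9 := hcap σ f hfi hf.2
          linarith
        obtain ⟨g1, g2, g3⟩ := card_sub_one_le_of_subset_copyEdges hμ hfi hσne hf.2 hnf
        refine (h2 _ _ g1 g2 hσne.card_pos g3).trans ?_
        have : τ ^ (σ.card - 1) ≤ 2 / κ * d 𝓕 σ := by
          rw [div_mul_eq_mul_div, le_div_iff₀ hκ]; linarith
        calc C * r ^ 2 * τ ^ (σ.card - 1) ≤ C * r ^ 2 * (2 / κ * d 𝓕 σ) := by gcongr
          _ = _ := by ring
      refine (Finset.sum_le_sum hterm).trans ?_
      rw [← Finset.mul_sum]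
      have hsum : ∑ σ ∈ sat, (d 𝓕 σ : ℝ) ≤ 2 ^ ℓ * 𝓕.card := by
        refine (Finset.sum_le_univ_sum_of_nonneg fun σ => by positivity).trans ?_
        have e1 : ∀ σ, (d 𝓕 σ : ℝ) = wdeg (copyWeight H 𝓕) σ := fun σ =>
          (wdeg_copyWeight 𝓕 σ).symm
        simp only [e1]
        rw [sum_wdeg, ← sum_copyWeight (H := H), Finset.mul_sum]
        refine le_of_eq (Finset.sum_congr rfl fun e _ => ?_)
        by_cases he : copyWeight H 𝓕 e = 0
        · simp [he]
        · obtain ⟨f, hf, rfl⟩ := exists_of_copyWeight_ne_zero he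
          rw [card_copyEdges H (h𝓕.1 f hf).1]
      calc 2 * C * r ^ 2 / κ * ∑ σ ∈ sat, (d 𝓕 σ : ℝ) ≤ 2 * C * r ^ 2 / κ * (2 ^ ℓ * M) := by
            refine mul_le_mul_of_nonneg_left (hsum.trans ?_) (by positivity)
            gcongr
        _ = r ^ 2 / κ * (2 * C * 2 ^ ℓ * M) := by ring
        _ ≤ r ^ 2 / κ * (κ * (X.card / 8)) := by gcongr
        _ = _ := by field_simp
    have hFb : β * (𝓕.card * r ^ h) ≤ X.card * r ^ 2 / 8 := by
      refine le_trans ?_ h4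
      gcongr
    -- On average at least |X|r²/2 pairs fall into `U`, while saturated sets and β-weighted old
    -- copies cost at most |X|r²/8 each. This leaves |X|r²/4.
    obtain ⟨U, hU, hle⟩ := exists_subset_of_average hu hun X Sym2.toFinset
      (fun e he => Sym2.card_toFinset_of_not_isDiag e (hX e he)) sat cover 𝓕
      (fun f => Finset.univ.image f) h (fun f hf => by
        rw [Finset.card_image_of_injective _ (h𝓕.1 f hf).1, Finset.card_univ, hh,
          Nat.card_eq_fintype_card]) β hβ.le
    rw [← hr] at hle
    set T : ℝ := (X.filter (Sym2.toFinset · ⊆ U)).card - (sat.filter (cover · ⊆ U)).card with hT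
    have hFnn : (0 : ℝ) ≤ β * (𝓕.filter fun f => Finset.univ.image f ⊆ U).card := by positivity
    have hTl : X.card * r ^ 2 / 4 + β * (𝓕.filter fun f => Finset.univ.image f ⊆ U).card ≤ T := by
      linarith
    have hXr : (0 : ℝ) < X.card * r ^ 2 / 4 := by
      have : (0 : ℝ) < X.card := by exact_mod_cast hXne.card_pos
      positivity
    obtain ⟨f, hf1, hf2, hf3, hf4⟩ := exists_new_copy hn hc hg X hX sat (fun σ hσ => by
      simp only [hsat, Finset.mem_filter] at hσ
      exact hσ.2.1) 𝓕 U hU T (by linarith) hT.le (by linarith) (by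
      have := h6 T (by linarith)
      have h7 : β * (𝓕.filter fun f => Finset.univ.image f ⊆ U).card < β * (c * T ^ ℓ) := by
        linarith
      exact lt_of_mul_lt_mul_left h7 hβ.le)
    have hnew : adm (insert f 𝓕) := by
      refine ⟨fun f' hf' => ?_, fun σ hσ => ?_⟩
      · rcases Finset.mem_insert.1 hf' with rfl | hf'
        · exact ⟨hf1, hf2⟩
        · exact h𝓕.1 f' hf'
      · by_cases hσf : σ ⊆ copyEdges H f
        · have hns : σ ∉ sat := fun hs => hf4 σ hs hσf
          simp only [hsat, Finset.mem_filter, Finset.mem_univ, true_and, not_and, not_le] at hns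
          have hlt' := hns hσ
          have h8 : d (insert f 𝓕) σ ≤ d 𝓕 σ + 1 := by
            simp only [d, Finset.filter_insert, if_pos hσf]
            exact Finset.card_insert_le _ _
          have h8' : (d (insert f 𝓕) σ : ℝ) ≤ d 𝓕 σ + 1 := by exact_mod_cast h8
          have h9 := hcap σ f hf1 hσf
          have : (0 : ℝ) ≤ (h : ℝ) ^ h := by positivity
          linarith
        · have h8 : d (insert f 𝓕) σ = d 𝓕 σ := by
            simp only [d, Finset.filter_insert, if_neg hσf]
          rw [h8]
          exact h𝓕.2 σ hσ
    have := hmax _ hnew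
    rw [Finset.card_insert_of_notMem hf3] at this
    omega
  refine ⟨copyWeight H 𝓕, ⟨fun e => by unfold copyWeight; positivity, fun e he => ?_,
    fun e he => ?_, fun σ hσ => ?_⟩, by rwa [sum_copyWeight], fun I hI e he => ?_⟩
  · obtain ⟨f, hf, rfl⟩ := exists_of_copyWeight_ne_zero he
    exact (h𝓕.1 f hf).2
  · obtain ⟨f, hf, rfl⟩ := exists_of_copyWeight_ne_zero he
    exact card_copyEdges H (h𝓕.1 f hf).1
  · rw [wdeg_copyWeight]; exact h𝓕.2 σ hσ
  · by_contra hne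
    obtain ⟨f, hf, rfl⟩ := exists_of_copyWeight_ne_zero hne
    have hfi := (h𝓕.1 f hf).1
    refine hI ⟨⟨⟨f, fun {a b} hab => ?_⟩, hfi⟩⟩
    rw [SimpleGraph.fromEdgeSet_adj]
    exact ⟨he (mem_copyEdges.2 ⟨s(a, b), hab, rfl⟩), fun h => hab.ne (hfi h)⟩

/-- The weight of the family produced by supersaturation, computed in closed form. -/
theorem family_weight_identity {u n c₀ b a y : ℝ} (hu : 0 < u) (hn : 0 < n) (ha : 0 < a)
    (hy : 0 < y) (hya : u ^ 2 = y * a) (q h : ℕ) :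
    (u / n) ^ 2 * (c₀ / u ^ (2 * ((q + 1 : ℕ) : ℤ) - (h : ℤ)) * (b * a) ^ q) / (u / n) ^ h =
      c₀ * b ^ q * (n ^ h / (n ^ 2 * y ^ q)) := by
  have e1 : u ^ (2 * ((q + 1 : ℕ) : ℤ) - (h : ℤ)) = u ^ 2 * (y ^ q * a ^ q) / u ^ h := by
    rw [zpow_sub₀ hu.ne', ← mul_pow, ← hya]
    congr 1
    · rw [← pow_mul, ← pow_add, ← zpow_natCast]
      congr 1
      push_cast; ring
  rw [e1, mul_pow, div_pow, div_pow]
  field_simp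

theorem card_finset_sym2_le {n : ℕ} (X : Finset (Sym2 (Fin n))) : X.card ≤ n ^ 2 := by
  have h1 : X.card ≤ n * (n + 1) / 2 := by
    have := Finset.card_le_univ X
    rw [Sym2.card, Fintype.card_fin, Nat.choose_two_right] at this
    simpa [mul_comm] using this
  refine h1.trans ((Nat.div_le_div_right (c := 2) (b := n ^ 2 * 2) ?_).trans (by simp))
  nlinarith

/-- Here `v` and `j` stand for v(F) - 2 and e(F) - 1: the density bound turns a power of the
sampling rate into a power of τ. -/
theorem pow_le_pow_of_density {k γ μ : ℝ} (hk : 1 ≤ k) (hγ : 0 < γ) (hμ : 0 < μ) {v j : ℕ}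
    (h : (j : ℝ) ≤ μ * v) : (k ^ (-(1 / γ))) ^ v ≤ (k ^ (-(1 / (μ * γ)))) ^ j := by
  have hk0 : 0 ≤ k := by linarith
  rw [← Real.rpow_natCast, ← Real.rpow_mul hk0, ← Real.rpow_natCast, ← Real.rpow_mul hk0]
  refine Real.rpow_le_rpow_of_exponent_le hk ?_
  have : 1 / (μ * γ) * j ≤ 1 / γ * v := by
    rw [div_mul_eq_mul_div, div_mul_eq_mul_div, div_le_div_iff₀ (by positivity) hγ]
    nlinarith
  linarith

set_option maxHeartbeats 1000000 in
/-- **Balanced supersaturation** for Erdős–Simonovits good graphs. -/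
theorem balanced_supersaturation {V : Type*} [Finite V] {H : SimpleGraph V} {α μ : ℝ}
    (hℓ : 2 ≤ H.edgeSet.ncard) (hα2 : α < 2) (hμ0 : 0 < μ)
    (hμ : ∀ F : H.Subgraph, F ≠ ⊤ → 2 < F.verts.ncard →
      (F.edgeSet.ncard : ℝ) - 1 ≤ μ * ((F.verts.ncard : ℝ) - 2))
    (hgood : ErdosSimonovitsGood H α) :
    ∃ k₀ ρ : ℝ, 1 ≤ k₀ ∧ 0 < ρ ∧ ∀ (n : ℕ) (X : Finset (Sym2 (Fin n))) (k τ : ℝ), 0 < n →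
      (∀ e ∈ X, ¬ e.IsDiag) → (X.card : ℝ) = k * (n : ℝ) ^ α → k₀ ≤ k → 0 < τ → τ ≤ 1 →
      k ^ (-(1 / (μ * (2 - α)))) ≤ τ → 1 ≤ τ * (k * (n : ℝ) ^ phi H α) →
      ∃ (κ : ℝ) (w : Finset (Sym2 (Fin n)) → ℝ), 0 < κ ∧ Bounded X H.edgeSet.ncard κ τ w ∧
        ρ * κ * X.card ≤ ∑ e, w e ∧
        ∀ I : Finset (Sym2 (Fin n)), H.Free (SimpleGraph.fromEdgeSet (I : Set (Sym2 (Fin n)))) →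
          WIndep w I := by
  have := Fintype.ofFinite V
  obtain ⟨K, c₀, hK, hc₀, hev⟩ := hgood
  obtain ⟨u₀, hu₀⟩ := eventually_atTop.1 hev
  obtain ⟨q, hq⟩ : ∃ q, H.edgeSet.ncard = q + 1 := ⟨_, (Nat.sub_add_cancel (by omega)).symm⟩
  have hq1 : 1 ≤ q := by omega
  set h := Nat.card V with hh
  have h2α : 0 < 2 - α := by linarith
  set b : ℝ := 1 / (2 - α) with hb
  have hb0 : 0 < b := by positivity
  set N₀ : ℝ := max u₀ 2 with hN₀
  have hN₀2 : 2 ≤ N₀ := le_max_right _ _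
  -- `B` is the factor by which the sampled graph exceeds u^α. The entry 8K puts it above the
  -- goodness threshold, and N₀^(2-α) makes the sample large enough for goodness to apply.
  set B : ℝ := max 1 (max (8 * K) (N₀ ^ (2 - α))) with hB
  have hB1 : 1 ≤ B := le_max_left _ _
  have hBK : 8 * K ≤ B := (le_max_left _ _).trans (le_max_right _ _)
  have hBN : N₀ ≤ B ^ b := by
    have h1 : N₀ ^ (2 - α) ≤ B := (le_max_right _ _).trans (le_max_right _ _)
    calc N₀ = (N₀ ^ (2 - α)) ^ b := by
          rw [← Real.rpow_mul (by linarith), hb, mul_one_div_cancel h2α.ne', Real.rpow_one]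
      _ ≤ B ^ b := Real.rpow_le_rpow (by positivity) h1 hb0.le
  set C : ℝ := (2 * B ^ b) ^ h with hC
  have hBb1 : 1 ≤ B ^ b := Real.one_le_rpow hB1 hb0.le
  set c₁ : ℝ := c₀ * (1 / 4) ^ q / (8 * (2 ^ (2 - α)) ^ q) with hc₁
  have hc₁0 : 0 < c₁ := by positivity
  set D : ℝ := max (16 * C * 2 ^ (q + 1)) (2 * ((h : ℝ) ^ h + 1) / c₁) with hD
  have hDC : 16 * C * 2 ^ (q + 1) ≤ D := le_max_left _ _
  have hDc : 2 * ((h : ℝ) ^ h + 1) / c₁ ≤ D := le_max_right _ _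
  have hD0 : 0 < D := lt_of_lt_of_le (by positivity) hDc
  refine ⟨B, 1 / D, hB1, by positivity, ?_⟩
  intro n X k τ hn hX hXk hk hτ hτ1 hτk hτn
  have hn0 : (0 : ℝ) < n := by exact_mod_cast hn
  have hk0 : 0 < k := by linarith
  have hX0 : (0 : ℝ) < X.card := by rw [hXk]; positivity
  have hXne : X.Nonempty := Finset.card_pos.1 (by exact_mod_cast hX0)
  set ν : ℝ := (B / k) ^ b with hν
  have hν0 : 0 < ν := by positivity
  -- The sampling rate solves k ν^(2-α) = B, so that |X| ν² = B (nν)^α: the sample keeps about B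
  -- times (nν)^α pairs.
  have hν1 : ν ≤ 1 := Real.rpow_le_one (by positivity) (by rw [div_le_one hk0]; exact hk) hb0.le
  have hkn : k ≤ (n : ℝ) ^ (2 - α) := by
    have h3 : k * (n : ℝ) ^ α ≤ (n : ℝ) ^ (2 : ℝ) := by
      rw [← hXk]; exact_mod_cast card_finset_sym2_le X
    have h4 : (n : ℝ) ^ (2 : ℝ) = (n : ℝ) ^ (2 - α) * (n : ℝ) ^ α := by
      rw [← Real.rpow_add hn0]; congr 1; ring
    rw [h4] at h3
    exact le_of_mul_le_mul_right h3 (by positivity)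
  have hkb : k ^ b ≤ n := by
    calc k ^ b ≤ ((n : ℝ) ^ (2 - α)) ^ b := Real.rpow_le_rpow hk0.le hkn hb0.le
      _ = n := by
        rw [← Real.rpow_mul hn0.le, hb, mul_one_div_cancel h2α.ne', Real.rpow_one]
  have hνk : ν = B ^ b * k ^ (-b) := by
    rw [hν, Real.div_rpow (by linarith) hk0.le, Real.rpow_neg hk0.le]; rfl
  have hnν : N₀ ≤ n * ν := by
    have : ν = B ^ b / k ^ b := by rw [hν, Real.div_rpow (by linarith) hk0.le]
    rw [this, ← mul_div_assoc, le_div_iff₀ (by positivity)]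
    calc N₀ * k ^ b ≤ B ^ b * n := by gcongr
      _ = _ := by ring
  set u : ℕ := ⌈n * ν⌉₊ with hu
  have hul : n * ν ≤ u := Nat.le_ceil _
  have huu : (u : ℝ) ≤ 2 * (n * ν) := by
    have := Nat.ceil_lt_add_one (show 0 ≤ n * ν by positivity)
    linarith
  have hu2 : 2 ≤ u := by
    have : (2 : ℝ) ≤ u := by linarith
    exact_mod_cast this
  have huu₀ : u₀ ≤ u := by
    have : (u₀ : ℝ) ≤ u := (le_max_left _ _).trans (hnν.trans hul)
    exact_mod_cast this
  have hun : u ≤ n := Nat.ceil_le.2 (by nlinarith)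
  have hu0 : (0 : ℝ) < u := by positivity
  set r : ℝ := u / n with hr
  have hr0 : 0 < r := by positivity
  have hrl : ν ≤ r := by rw [hr, le_div_iff₀ hn0]; linarith
  have hru : r ≤ 2 * ν := by rw [hr, div_le_iff₀ hn0]; linarith
  have hνα : ν ^ (2 - α) = B / k := by
    rw [hν, ← Real.rpow_mul (by positivity), hb, one_div_mul_cancel h2α.ne', Real.rpow_one]
  set a : ℝ := (u : ℝ) ^ α with ha
  have ha0 : 0 < a := by positivity
  set y : ℝ := (u : ℝ) ^ (2 - α) with hy
  have hy0 : 0 < y := by positivity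
  have hya : (u : ℝ) ^ 2 = y * a := by
    rw [hy, ha, ← Real.rpow_add hu0, ← Real.rpow_natCast]; congr 1; push_cast; ring
  set c : ℝ := c₀ / (u : ℝ) ^ (2 * ((q + 1 : ℕ) : ℤ) - (h : ℤ)) with hc
  have hcpos : 0 < c := by positivity
  set T₀ : ℝ := B / 4 * a with hT₀
  have hT₀0 : 0 < T₀ := by positivity
  have hT₀X : T₀ ≤ X.card * r ^ 2 / 4 := by
    have h1 : B ≤ k * r ^ (2 - α) := by
      have : ν ^ (2 - α) ≤ r ^ (2 - α) := Real.rpow_le_rpow hν0.le hrl h2α.le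
      rw [hνα, div_le_iff₀ hk0] at this
      linarith
    have h2 : (n : ℝ) ^ α * r ^ 2 = r ^ (2 - α) * a := by
      have : (u : ℝ) = r * n := by rw [hr]; field_simp
      rw [ha, this, Real.mul_rpow hr0.le hn0.le, ← mul_assoc, ← Real.rpow_add hr0,
        ← Real.rpow_natCast, mul_comm]
      congr 2; push_cast; ring
    rw [hT₀, hXk, mul_assoc, h2]
    have := mul_le_mul_of_nonneg_right h1 ha0.le
    linarith
  -- β is the exchange rate between edges and copies: T ≤ β c T^ℓ for T ≥ T₀. `M` is the family size
  -- for which the old copies cost exactly |X|r²/8, and κ is `D` times the average M/|X|.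
  set β : ℝ := 1 / (c * T₀ ^ q) with hβ
  have hβ0 : 0 < β := by positivity
  set M : ℝ := X.card * r ^ 2 / 8 / (β * r ^ h) with hM
  have hM0 : 0 < M := by positivity
  set κ : ℝ := D * M / X.card with hκ
  have hκ0 : 0 < κ := by positivity
  -- The source of φ: the copies per pair number at least a constant times (k n^φ)^(ℓ-1). Hence τ k
  -- n^φ ≥ 1 keeps the capacity of a full copy above a constant.
  have hMlow : c₁ * (k * (n : ℝ) ^ phi H α) ^ q ≤ M / X.card := by
    have e1 : M / X.card = r ^ 2 * (c * (B / 4 * a) ^ q) / r ^ h / 8 := by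
      rw [hM, hβ, ← hT₀]; field_simp
    rw [e1, hc, family_weight_identity hu0 hn0 ha0 hy0 hya]
    have hyu : y ≤ 2 ^ (2 - α) * (n : ℝ) ^ (2 - α) * (B / k) := by
      rw [hy, ← hνα, ← Real.mul_rpow (by norm_num) hn0.le, ← Real.mul_rpow (by positivity) hν0.le]
      exact Real.rpow_le_rpow hu0.le (by linarith) h2α.le
    have hphi : ((n : ℝ) ^ phi H α) ^ q * ((n : ℝ) ^ 2 * ((n : ℝ) ^ (2 - α)) ^ q) =
        (n : ℝ) ^ h := by
      rw [← Real.rpow_natCast, ← Real.rpow_natCast, ← Real.rpow_natCast, ← Real.rpow_natCast,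
        ← Real.rpow_mul hn0.le, ← Real.rpow_mul hn0.le, ← Real.rpow_add hn0, ← Real.rpow_add hn0]
      congr 1
      have hq0 : (q : ℝ) ≠ 0 := by positivity
      rw [phi, hq]
      push_cast
      rw [add_sub_cancel_right, div_mul_cancel₀ _ hq0]
      ring
    calc c₁ * (k * (n : ℝ) ^ phi H α) ^ q
        = c₀ * (B / 4) ^ q * ((n : ℝ) ^ h /
            ((n : ℝ) ^ 2 * (2 ^ (2 - α) * (n : ℝ) ^ (2 - α) * (B / k)) ^ q)) / 8 := by
          rw [← hphi, hc₁]
          simp only [mul_pow, div_pow, one_pow]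
          field_simp
      _ ≤ _ := by gcongr
  obtain ⟨w, hw1, hw2, hw3⟩ := exists_bounded_copyWeight (H := H) hμ hu2 hun (c := c)
    (t := K * a) hcpos (fun G hG => by
      have := hu₀ u huu₀ G hG
      rw [hq] at this ⊢
      rw [hc, div_mul_eq_mul_div]
      exact this) X hX (κ := κ) (τ := τ) (M := M) (β := β) (C := C) (r := r) hr hκ0 hτ hτ1 hβ0
    (by positivity) (by
      rw [hq, Nat.add_sub_cancel, hκ]
      calc 2 * ((h : ℝ) ^ h + 1) ≤ D * c₁ := by rwa [div_le_iff₀ hc₁0] at hDc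
        _ ≤ D * c₁ * (τ * (k * (n : ℝ) ^ phi H α)) ^ q :=
          le_mul_of_one_le_right (by positivity) (one_le_pow₀ hτn)
        _ = D * (c₁ * (k * (n : ℝ) ^ phi H α) ^ q) * τ ^ q := by rw [mul_pow]; ring
        _ ≤ D * (M / X.card) * τ ^ q := by gcongr
        _ = _ := by ring) (by
      intro v j hv2 hvh hj hjv
      obtain ⟨v', rfl⟩ : ∃ v', v = v' + 2 := ⟨v - 2, by omega⟩
      obtain ⟨j', rfl⟩ : ∃ j', j = j' + 1 := ⟨j - 1, by omega⟩
      simp only [Nat.add_sub_cancel]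
      push_cast at hjv
      simp only [add_sub_cancel_right] at hjv
      have h1 : r ^ v' ≤ C * τ ^ j' := by
        calc r ^ v' ≤ (2 * ν) ^ v' := by gcongr
          _ = (2 * B ^ b) ^ v' * (k ^ (-b)) ^ v' := by rw [hνk, ← mul_pow]; ring
          _ ≤ C * τ ^ j' := by
            gcongr
            · rw [hC]
              exact pow_le_pow_right₀ (by linarith) (by omega)
            · exact (pow_le_pow_of_density (by linarith) h2α hμ0 hjv).trans
                (pow_le_pow_left₀ (by positivity) hτk _)
      calc r ^ (v' + 2) = r ^ 2 * r ^ v' := by ring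
        _ ≤ r ^ 2 * (C * τ ^ j') := by gcongr
        _ = _ := by ring) (by
      rw [hq, hκ]
      calc 2 * C * 2 ^ (q + 1) * M = (16 * C * 2 ^ (q + 1)) * M / 8 := by ring
        _ ≤ D * M / 8 := by gcongr
        _ = _ := by field_simp) (by
      refine le_of_eq ?_
      rw [hM]; field_simp; simp [hh]) (by
      refine lt_of_lt_of_le ?_ hT₀X
      rw [hT₀]
      have : K * a < B / 4 * a := by
        refine mul_lt_mul_of_pos_right ?_ ha0
        linarith
      exact this) (by
      intro T hT
      have hT' : T₀ ≤ T := hT₀X.trans hT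
      rw [hq, hβ, pow_succ, one_div, ← div_eq_inv_mul, le_div_iff₀ (by positivity)]
      have : T₀ ^ q ≤ T ^ q := by gcongr
      have hT0 : 0 ≤ T := by linarith
      calc T * (c * T₀ ^ q) ≤ T * (c * T ^ q) := by gcongr
        _ = _ := by ring) hXne
  refine ⟨κ, w, hκ0, hw1, le_trans (le_of_eq ?_) hw2, hw3⟩
  rw [hκ]; field_simp

/-! ### One container step for `H`-free graphs -/

/-- The graph with edge set `I` contains no copy of `H`. -/
def FreeSet {V W : Type*} (H : SimpleGraph V) (I : Finset (Sym2 W)) : Prop :=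
  H.Free (SimpleGraph.fromEdgeSet (I : Set (Sym2 W)))

theorem FreeSet.mono {V W : Type*} {H : SimpleGraph V} {I J : Finset (Sym2 W)} (h : FreeSet H J)
    (hIJ : I ⊆ J) : FreeSet H I :=
  fun hc => h (hc.mono_right (SimpleGraph.fromEdgeSet_mono (by exact_mod_cast hIJ)))

/-- One container step for `H`-free edge sets. -/
theorem exists_freeSet_tree {V : Type*} [Finite V] {H : SimpleGraph V} {α μ : ℝ}
    (hℓ : 2 ≤ H.edgeSet.ncard) (hα2 : α < 2) (hμ0 : 0 < μ)
    (hμ : ∀ F : H.Subgraph, F ≠ ⊤ → 2 < F.verts.ncard →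
      (F.edgeSet.ncard : ℝ) - 1 ≤ μ * ((F.verts.ncard : ℝ) - 2))
    (hφ : 0 < phi H α) (hgood : ErdosSimonovitsGood H α) :
    ∃ k₀ δ A : ℝ, 1 ≤ k₀ ∧ 0 < δ ∧ δ < 1 ∧ 0 < A ∧
      ∀ (n : ℕ) (X : Finset (Sym2 (Fin n))) (k : ℝ), 0 < n → (∀ e ∈ X, ¬ e.IsDiag) →
      (X.card : ℝ) = k * (n : ℝ) ^ α → k₀ ≤ k →
      ∃ t : QueryTree (Sym2 (Fin n)) (Finset (Sym2 (Fin n))), ∀ I, FreeSet H I → I ⊆ X →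
        ((t.yes I).card : ℝ) ≤ A * (k ^ (1 - 1 / (μ * (2 - α))) * (n : ℝ) ^ α +
          ((n : ℝ) ^ (α - phi H α) + 1)) ∧
        I ⊆ t.yes I ∪ t.out I ∧ t.out I ⊆ X ∧ ((t.out I).card : ℝ) ≤ (1 - δ) * X.card := by
  obtain ⟨k₀, ρ, hk₀, hρ, hsup⟩ := balanced_supersaturation hℓ hα2 hμ0 hμ hgood
  obtain ⟨δ, hδ, hcont⟩ := exists_container_tree H.edgeSet.ncard (by omega) ρ hρ
  refine ⟨k₀, min δ (1 / 2), H.edgeSet.ncard, hk₀, by positivity,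
    (min_le_right _ _).trans_lt (by norm_num), by exact_mod_cast (by omega), ?_⟩
  intro n X k hn hX hXk hk
  set lam : ℝ := 1 / (μ * (2 - α)) with hlam
  have hlam0 : 0 < lam := by have : 0 < 2 - α := by linarith
                             positivity
  have hn0 : (0 : ℝ) < n := by exact_mod_cast hn
  have hn1 : (1 : ℝ) ≤ n := by exact_mod_cast hn
  have hk0 : 0 < k := by linarith
  have hnφ : 1 ≤ (n : ℝ) ^ phi H α := Real.one_le_rpow hn1 hφ.le
  set z : ℝ := k * (n : ℝ) ^ phi H α with hz
  have hz1 : 1 ≤ z := by nlinarith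
  -- This is the least τ allowed by supersaturation. Its two entries multiplied by |X| give the two
  -- main terms of the fingerprint size.
  set τ : ℝ := max (k ^ (-lam)) z⁻¹ with hτ
  have hτ0 : 0 < τ := lt_max_of_lt_left (by positivity)
  have hτ1 : τ ≤ 1 := max_le (Real.rpow_le_one_of_one_le_of_nonpos (by linarith) (by linarith))
    (inv_le_one_of_one_le₀ hz1)
  obtain ⟨κ, w, hκ, hw, hsum, hfree⟩ := hsup n X k τ hn hX hXk hk hτ0 hτ1 (le_max_left _ _) (by
    calc (1 : ℝ) = z⁻¹ * z := by rw [inv_mul_cancel₀]; positivity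
      _ ≤ τ * z := by gcongr; exact le_max_right _ _)
  have hX0 : (0 : ℝ) < X.card := by rw [hXk]; positivity
  obtain ⟨t, ht⟩ := hcont (Sym2 (Fin n)) X κ τ w hκ hτ0
    (Finset.card_pos.1 (by exact_mod_cast hX0)) hw hsum
  refine ⟨t, fun I hI hIX => ?_⟩
  obtain ⟨h1, h2, h3, h4⟩ := ht I (hfree I hI) hIX
  refine ⟨h1.trans ?_, h2, h3, h4.trans ?_⟩
  · refine mul_le_mul_of_nonneg_left ?_ (by positivity)
    have e1 : k ^ (-lam) * X.card = k ^ (1 - lam) * (n : ℝ) ^ α := by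
      rw [hXk, sub_eq_neg_add, Real.rpow_add hk0, Real.rpow_one]; ring
    have e2 : z⁻¹ * X.card = (n : ℝ) ^ (α - phi H α) := by
      rw [hXk, Real.rpow_sub hn0, hz]; field_simp
    have : τ ≤ k ^ (-lam) + z⁻¹ := max_le_add_of_nonneg (by positivity) (by positivity)
    have := mul_le_mul_of_nonneg_right this hX0.le
    linarith
  · have : min δ (1 / 2) ≤ δ := min_le_left _ _
    nlinarith

/-! ### Iterated containers and weighted counts of fingerprints -/

section Iteration

variable {E : Type*}

theorem sum_pow_card_le_exp {q : ℝ} (hq : 0 ≤ q) (X : Finset E) :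
    ∑ S ∈ X.powerset, q ^ S.card ≤ Real.exp (q * X.card) := by
  have := Finset.prod_add_one (f := fun _ : E => q) (s := X)
  simp only [Finset.prod_const] at this
  rw [← this, mul_comm, Real.exp_nat_mul]
  exact pow_le_pow_left₀ (by positivity) (by linarith [Real.add_one_le_exp q]) _

/-- Exponential tilting: each summand is multiplied by exp(y(s - |S|)) ≥ 1, and the sum is then
extended to all subsets. -/
theorem sum_small_pow_card_le {q y s : ℝ} (hq : 0 ≤ q) (hy : 0 ≤ y) (X : Finset E) :
    ∑ S ∈ X.powerset.filter (fun S => (S.card : ℝ) ≤ s), q ^ S.card ≤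
      Real.exp (y * s + q * Real.exp (-y) * X.card) := by
  calc _ ≤ ∑ S ∈ X.powerset.filter (fun S => (S.card : ℝ) ≤ s),
        Real.exp (y * s) * (q * Real.exp (-y)) ^ S.card := by
        refine Finset.sum_le_sum fun S hS => ?_
        have hS' := (Finset.mem_filter.1 hS).2
        rw [mul_pow, ← Real.exp_nat_mul, mul_left_comm, ← Real.exp_add]
        refine le_mul_of_one_le_right (by positivity) (Real.one_le_exp ?_)
        nlinarith
    _ ≤ ∑ S ∈ X.powerset, Real.exp (y * s) * (q * Real.exp (-y)) ^ S.card :=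
        Finset.sum_le_sum_of_subset_of_nonneg (Finset.filter_subset _ _)
          fun _ _ _ => by positivity
    _ ≤ _ := by
        rw [← Finset.mul_sum, Real.exp_add]
        gcongr
        exact sum_pow_card_le_exp (by positivity) X

/-- The same tilting in the opposite direction, with the factor exp(|S| - r) ≥ 1. -/
theorem sum_large_pow_card_le {q r : ℝ} (hq : 0 ≤ q) (X : Finset E) :
    ∑ S ∈ X.powerset.filter (fun S => r ≤ (S.card : ℝ)), q ^ S.card ≤
      Real.exp (-r + q * Real.exp 1 * X.card) := by
  calc _ ≤ ∑ S ∈ X.powerset.filter (fun S => r ≤ (S.card : ℝ)),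
        Real.exp (-r) * (q * Real.exp 1) ^ S.card := by
        refine Finset.sum_le_sum fun S hS => ?_
        have hS' := (Finset.mem_filter.1 hS).2
        rw [mul_pow, ← Real.exp_nat_mul, mul_left_comm, ← Real.exp_add]
        refine le_mul_of_one_le_right (by positivity) (Real.one_le_exp ?_)
        linarith
    _ ≤ ∑ S ∈ X.powerset, Real.exp (-r) * (q * Real.exp 1) ^ S.card :=
        Finset.sum_le_sum_of_subset_of_nonneg (Finset.filter_subset _ _)
          fun _ _ _ => by positivity
    _ ≤ _ := by
        rw [← Finset.mul_sum, Real.exp_add]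
        gcongr
        exact sum_pow_card_le_exp (by positivity) X

variable [DecidableEq E]

theorem sum_biUnion_le_sum_sum {ι : Type*} (s : Finset ι) (L : ι → Finset E)
    {g : E → ℝ} (hg : ∀ e, 0 ≤ g e) : ∑ e ∈ s.biUnion L, g e ≤ ∑ i ∈ s, ∑ e ∈ L i, g e := by
  classical
  induction s using Finset.induction_on with
  | empty => simp
  | insert i s hi ih =>
    rw [Finset.biUnion_insert, Finset.sum_insert hi]
    have := Finset.sum_union_inter (s₁ := L i) (s₂ := s.biUnion L) (f := g)
    have h0 : 0 ≤ ∑ e ∈ L i ∩ s.biUnion L, g e := Finset.sum_nonneg fun e _ => hg e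
    linarith

/-- Iterating container steps: every set in a down-closed family `P` is covered by a fingerprint
and a small container, and the fingerprints have controlled total weight. -/
theorem exists_container_family {P : Finset E → Prop} (hP : ∀ I J, P J → I ⊆ J → P I)
    {X₀ : Finset E} {N s y : ℕ → ℝ} {q : ℝ} (hq : 0 ≤ q) (hs : ∀ i, 0 ≤ s i) (hy : ∀ i, 0 ≤ y i)
    (hN : ∀ i, 0 ≤ N i)
    (hstep : ∀ i, ∀ X ⊆ X₀, N i < X.card → (X.card : ℝ) ≤ N (i + 1) →
      ∃ t : QueryTree E (Finset E), ∀ I, P I → I ⊆ X → ((t.yes I).card : ℝ) ≤ s i ∧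
        I ⊆ t.yes I ∪ t.out I ∧ t.out I ⊆ X ∧ ((t.out I).card : ℝ) ≤ N i) (t : ℕ) :
    ∀ X ⊆ X₀, (X.card : ℝ) ≤ N t → ∃ L : Finset (Finset E × Finset E),
      (∀ c ∈ L, c.1 ⊆ X ∧ c.2 ⊆ X ∧ Disjoint c.1 c.2 ∧
        (c.1.card : ℝ) ≤ ∑ i ∈ Finset.range t, s i ∧ (c.2.card : ℝ) ≤ N 0) ∧
      (∀ I, P I → I ⊆ X → ∃ c ∈ L, c.1 ⊆ I ∧ I ⊆ c.1 ∪ c.2) ∧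
      ∑ c ∈ L, q ^ c.1.card ≤
        Real.exp (∑ i ∈ Finset.range t, (y i * s i + q * Real.exp (-y i) * N (i + 1))) := by
  induction t with
  | zero =>
    intro X hX hXN
    refine ⟨{(∅, X)}, ?_, ?_, by simp⟩
    · simpa using hXN
    · intro I _ hI
      exact ⟨(∅, X), by simp, by simp, by simpa using hI⟩
  | succ t ih =>
    intro X hX hXN
    have hnn : 0 ≤ y t * s t + q * Real.exp (-y t) * N (t + 1) :=
      add_nonneg (mul_nonneg (hy _) (hs _)) (mul_nonneg (by positivity) (hN _))
    by_cases hsmall : (X.card : ℝ) ≤ N t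
    · obtain ⟨L, h1, h2, h3⟩ := ih X hX hsmall
      refine ⟨L, fun c hc => ?_, h2, h3.trans ?_⟩
      · obtain ⟨g1, g2, g3, g4, g5⟩ := h1 c hc
        refine ⟨g1, g2, g3, g4.trans ?_, g5⟩
        rw [Finset.sum_range_succ]; linarith [hs t]
      · rw [Finset.sum_range_succ]
        exact Real.exp_le_exp.2 (by linarith)
    · push Not at hsmall
      obtain ⟨T, hT⟩ := hstep t X hX hsmall hXN
      -- The container depends on the fingerprint `S` alone, so one family is built for each `S`.
      -- Recursing on `T.out S \ S` keeps successive fingerprints disjoint, so their weights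
      -- multiply.
      have key : ∀ S : Finset E, ∃ L : Finset (Finset E × Finset E),
          (∀ c ∈ L, (c.1 ⊆ X ∧ Disjoint S c.1) ∧ (c.2 ⊆ X ∧ Disjoint S c.2) ∧ Disjoint c.1 c.2 ∧
            (c.1.card : ℝ) ≤ ∑ i ∈ Finset.range t, s i ∧ (c.2.card : ℝ) ≤ N 0) ∧
          (∀ I, P I → I ⊆ X → T.yes I = S → ∃ c ∈ L, c.1 ⊆ I ∧ I ⊆ S ∪ c.1 ∪ c.2) ∧
          ∑ c ∈ L, q ^ c.1.card ≤
            Real.exp (∑ i ∈ Finset.range t, (y i * s i + q * Real.exp (-y i) * N (i + 1))) := by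
        intro S
        by_cases hg : T.out S ⊆ X ∧ ((T.out S).card : ℝ) ≤ N t
        · obtain ⟨L, h1, h2, h3⟩ := ih (T.out S \ S)
            (Finset.sdiff_subset.trans (hg.1.trans hX))
            (le_trans (by exact_mod_cast Finset.card_le_card Finset.sdiff_subset) hg.2)
          refine ⟨L, fun c hc => ?_, fun I hI hIX hIS => ?_, h3⟩
          · obtain ⟨g1, g2, g3⟩ := h1 c hc
            exact ⟨⟨g1.trans (Finset.sdiff_subset.trans hg.1),
                Finset.disjoint_of_subset_right g1 Finset.disjoint_sdiff⟩,
              ⟨g2.trans (Finset.sdiff_subset.trans hg.1),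
                Finset.disjoint_of_subset_right g2 Finset.disjoint_sdiff⟩, g3⟩
          · have hSI : S ⊆ I := hIS ▸ T.yes_subset I
            have hout : T.out S = T.out I := T.out_eq_of_yes_subset hSI hIS.subset
            have hsub := (hT I hI hIX).2.1
            rw [hIS, ← hout] at hsub
            obtain ⟨c, hc, hc1, hc2⟩ := h2 (I \ S) (hP _ _ hI Finset.sdiff_subset) (by
              intro x hx
              rw [Finset.mem_sdiff] at hx ⊢
              exact ⟨(Finset.mem_union.1 (hsub hx.1)).resolve_left hx.2, hx.2⟩)
            refine ⟨c, hc, hc1.trans Finset.sdiff_subset, fun x hx => ?_⟩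
            by_cases hxS : x ∈ S
            · simp [hxS]
            · have := hc2 (Finset.mem_sdiff.2 ⟨hx, hxS⟩)
              simp only [Finset.mem_union] at this ⊢
              tauto
        · refine ⟨∅, by simp, fun I hI hIX hIS => absurd ?_ hg, by simp; positivity⟩
          have hSI : S ⊆ I := hIS ▸ T.yes_subset I
          rw [T.out_eq_of_yes_subset hSI hIS.subset]
          exact (hT I hI hIX).2.2
      choose Lf hL1 hL2 hL3 using key
      set SS := X.powerset.filter (fun S => (S.card : ℝ) ≤ s t) with hSS
      refine ⟨SS.biUnion fun S => (Lf S).image fun c => (S ∪ c.1, c.2), ?_, ?_, ?_⟩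
      · intro c hc
        simp only [Finset.mem_biUnion, Finset.mem_image] at hc
        obtain ⟨S, hS, c', hc', rfl⟩ := hc
        rw [hSS, Finset.mem_filter, Finset.mem_powerset] at hS
        obtain ⟨⟨g1, g1'⟩, ⟨g2, g2'⟩, g3, g4, g5⟩ := hL1 S c' hc'
        refine ⟨Finset.union_subset hS.1 g1, g2, Finset.disjoint_union_left.2 ⟨g2', g3⟩, ?_, g5⟩
        rw [Finset.sum_range_succ, Finset.card_union_of_disjoint g1']
        push_cast; linarith [hS.2]
      · intro I hI hIX
        have hsz := (hT I hI hIX).1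
        obtain ⟨c, hc, hc1, hc2⟩ := hL2 (T.yes I) I hI hIX rfl
        refine ⟨(T.yes I ∪ c.1, c.2), ?_, Finset.union_subset (T.yes_subset I) hc1, hc2⟩
        refine Finset.mem_biUnion.2 ⟨T.yes I, ?_, Finset.mem_image_of_mem _ hc⟩
        rw [hSS, Finset.mem_filter, Finset.mem_powerset]
        exact ⟨(T.yes_subset I).trans hIX, hsz⟩
      · rw [Finset.sum_range_succ, add_comm, Real.exp_add]
        calc _ ≤ ∑ S ∈ SS, ∑ c ∈ (Lf S).image fun c => (S ∪ c.1, c.2), q ^ c.1.card :=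
              sum_biUnion_le_sum_sum _ _ fun _ => by positivity
          _ ≤ ∑ S ∈ SS, ∑ c ∈ Lf S, q ^ S.card * q ^ c.1.card := by
              refine Finset.sum_le_sum fun S _ => ?_
              refine (Finset.sum_image_le_of_nonneg (fun _ _ => by positivity)).trans
                (le_of_eq (Finset.sum_congr rfl fun c hc => ?_))
              rw [← pow_add, Finset.card_union_of_disjoint (hL1 S c hc).1.2]
          _ ≤ ∑ S ∈ SS, q ^ S.card * Real.exp (∑ i ∈ Finset.range t,
                (y i * s i + q * Real.exp (-y i) * N (i + 1))) := by
              refine Finset.sum_le_sum fun S _ => ?_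
              rw [← Finset.mul_sum]
              exact mul_le_mul_of_nonneg_left (hL3 S) (by positivity)
          _ ≤ _ := by
              rw [← Finset.sum_mul]
              gcongr
              refine (sum_small_pow_card_le hq (hy t) X).trans (Real.exp_le_exp.2 ?_)
              gcongr

end Iteration

/-- A partial sum of the differentiated geometric series, with its remainder in closed form. -/
theorem sum_range_succ_mul_pow_le {θ : ℝ} (h0 : 0 ≤ θ) (h1 : θ < 1) (t : ℕ) :
    ∑ i ∈ Finset.range t, ((i : ℝ) + 1) * θ ^ i ≤ 1 / (1 - θ) ^ 2 := by
  have key : (∑ i ∈ Finset.range t, ((i : ℝ) + 1) * θ ^ i) * (1 - θ) ^ 2 =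
      1 - θ ^ t * (1 + t * (1 - θ)) := by
    induction t with
    | zero => simp
    | succ t ih => rw [Finset.sum_range_succ, add_mul, ih]; push_cast; ring
  rw [le_div_iff₀ (by nlinarith), key]
  have : 0 ≤ θ ^ t * (1 + t * (1 - θ)) := by
    have : 0 ≤ 1 - θ := by linarith
    positivity
  linarith

theorem sum_range_pow_le {θ : ℝ} (h0 : 0 ≤ θ) (h1 : θ < 1) (t : ℕ) :
    ∑ i ∈ Finset.range t, θ ^ i ≤ 1 / (1 - θ) ^ 2 := by
  refine (Finset.sum_le_sum fun i _ => ?_).trans (sum_range_succ_mul_pow_le h0 h1 t)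
  refine le_mul_of_one_le_left (by positivity) ?_
  have : (0 : ℝ) ≤ i := by positivity
  linarith

theorem sum_range_succ_le_sq (t : ℕ) : ∑ i ∈ Finset.range t, ((i : ℝ) + 1) ≤ (t : ℝ) ^ 2 := by
  calc _ ≤ ∑ i ∈ Finset.range t, (t : ℝ) := Finset.sum_le_sum fun i hi => by
        exact_mod_cast Finset.mem_range.1 hi
    _ = _ := by simp [sq]

/-- The container family for `H`-free graphs at the scale relevant for edge density `q`. -/
theorem exists_freeSet_family {V : Type*} [Finite V] {H : SimpleGraph V} {α μ lam : ℝ}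
    (hℓ : 2 ≤ H.edgeSet.ncard) (hα : 0 < α) (hα2 : α < 2) (hμ0 : 0 < μ)
    (hμ : ∀ F : H.Subgraph, F ≠ ⊤ → 2 < F.verts.ncard →
      (F.edgeSet.ncard : ℝ) - 1 ≤ μ * ((F.verts.ncard : ℝ) - 2))
    (hφ : 0 < phi H α) (hgood : ErdosSimonovitsGood H α)
    (hlam : lam = 1 / (μ * (2 - α))) (hlam1 : 1 < lam) :
    ∃ A : ℝ, 0 < A ∧ ∀ (n : ℕ) (q x : ℝ), 3 ≤ n → 0 < q → q ≤ 1 →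
      x = q ^ (1 - 1 / lam) * (n : ℝ) ^ α →
      (n : ℝ) ^ (α - phi H α) * Real.log n ^ 2 ≤ x → Real.log n ^ 2 ≤ x →
      ∃ L : Finset (Finset (Sym2 (Fin n)) × Finset (Sym2 (Fin n))),
        (∀ c ∈ L, Disjoint c.1 c.2 ∧ (c.1.card : ℝ) ≤ A * x ∧ q * (c.2.card : ℝ) ≤ A * x) ∧
        (∀ I, FreeSet H I → (∀ e ∈ I, ¬ e.IsDiag) → ∃ c ∈ L, c.1 ⊆ I ∧ I ⊆ c.1 ∪ c.2) ∧
        ∑ c ∈ L, q ^ c.1.card ≤ Real.exp (A * x) := by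
  obtain ⟨k₀, δ, A, hk₀, hδ, hδ1, hA, hstep⟩ := exists_freeSet_tree hℓ hα2 hμ0 hμ hφ hgood
  rw [← hlam] at hstep
  have h1δ : 0 < 1 - δ := by linarith
  set γ : ℝ := (1 - δ)⁻¹ with hγ
  have hγ1 : 1 < γ := (one_lt_inv₀ h1δ).2 (by linarith)
  have hγ0 : 0 < γ := by linarith
  set ℓγ : ℝ := Real.log γ with hℓγ
  have hℓγ0 : 0 < ℓγ := Real.log_pos hγ1
  -- The main term of the fingerprint size changes by the factor θ per level; θ < 1 is where λ > 1
  -- is used.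
  set θ : ℝ := γ ^ (1 - lam) with hθ
  have hθ0 : 0 < θ := by positivity
  have hθ1 : θ < 1 := Real.rpow_lt_one_of_one_lt_of_neg hγ1 (by linarith)
  have hθexp : Real.exp (-(lam * ℓγ)) * γ = θ := by
    rw [hθ, Real.rpow_def_of_pos hγ0, ← hℓγ, show ℓγ * (1 - lam) = -(lam * ℓγ) + ℓγ by ring,
      Real.exp_add, hℓγ, Real.exp_log hγ0]
  set g : ℝ := 1 / (1 - θ) ^ 2 with hg
  have hg0 : 0 < g := by have : 0 < 1 - θ := by linarith
                         positivity
  set W : ℝ := 2 * (2 / ℓγ + 1) ^ 2 with hW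
  have hW0 : 0 < W := by positivity
  have hlam0 : 0 < lam := by linarith
  refine ⟨(lam * ℓγ * A + k₀) * g + lam * ℓγ * A * W + A * (g + W) + k₀, by positivity, ?_⟩
  intro n q x hn hq hq1 hx hx1 hx2
  have hn0 : (0 : ℝ) < n := by positivity
  have hnα : 0 < (n : ℝ) ^ α := by positivity
  have hn1 : (1 : ℝ) ≤ n := by exact_mod_cast (by omega : 1 ≤ n)
  have hx0 : 0 < x := by rw [hx]; positivity
  have hlog1 : 1 ≤ Real.log n := by
    rw [Real.le_log_iff_exp_le hn0]
    have : (3 : ℝ) ≤ n := by exact_mod_cast hn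
    linarith [Real.exp_one_lt_d9]
  set Z : ℝ := (n : ℝ) ^ (α - phi H α) + 1 with hZ
  have hZ0 : 0 < Z := by positivity
  -- The final container size is chosen so that its expected number of edges at density `q` is `k₀ *
  -- x`, matching the fingerprint cost.
  set kf : ℝ := k₀ * q ^ (-(1 / lam)) with hkf
  have hqlam : 1 ≤ q ^ (-(1 / lam)) :=
    Real.one_le_rpow_of_pos_of_le_one_of_nonpos hq hq1 (by
      have : 0 < 1 / lam := by positivity
      linarith)
  have hkf1 : k₀ ≤ kf := le_mul_of_one_le_right (by linarith) hqlam
  have hkf0 : 0 < kf := by linarith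
  have hqkf : q * (kf * (n : ℝ) ^ α) = k₀ * x := by
    have : q * q ^ (-(1 / lam)) = q ^ (1 - 1 / lam) := by
      rw [sub_eq_add_neg, Real.rpow_add hq, Real.rpow_one]
    rw [hx, hkf, ← this]; ring
  set t : ℕ := ⌈2 * Real.log n / ℓγ⌉₊ with ht
  have htu : (t : ℝ) ≤ (2 / ℓγ + 1) * Real.log n := by
    have := Nat.ceil_lt_add_one (show 0 ≤ 2 * Real.log n / ℓγ by positivity)
    calc (t : ℝ) ≤ 2 * Real.log n / ℓγ + 1 := this.le
      _ ≤ 2 * Real.log n / ℓγ + Real.log n := by linarith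
      _ = _ := by ring
  have htl : 2 * Real.log n ≤ t * ℓγ := by
    have := Nat.le_ceil (2 * Real.log n / ℓγ)
    rwa [div_le_iff₀ hℓγ0] at this
  -- The non-decaying cost `Z` occurs at `t = O(log n)` levels with tilts up to a multiple of `t`.
  -- The total Z t² is absorbed by `x`, which is the origin of (log n)².
  have hZt : Z * (t : ℝ) ^ 2 ≤ W * x := by
    calc Z * (t : ℝ) ^ 2 ≤ Z * ((2 / ℓγ + 1) * Real.log n) ^ 2 := by gcongr
      _ = (2 / ℓγ + 1) ^ 2 * (Z * Real.log n ^ 2) := by ring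
      _ ≤ (2 / ℓγ + 1) ^ 2 * (2 * x) := by
        refine mul_le_mul_of_nonneg_left ?_ (by positivity)
        rw [hZ, add_mul, one_mul]; linarith
      _ = _ := by rw [hW]; ring
  have hNt : ((n ^ 2 : ℕ) : ℝ) ≤ kf * (n : ℝ) ^ α * γ ^ t := by
    have h1 : (n : ℝ) ^ 2 ≤ γ ^ t := by
      rw [← Real.exp_log (pow_pos hγ0 t), Real.log_pow, ← Real.exp_log (pow_pos hn0 2),
        Real.log_pow]
      exact Real.exp_le_exp.2 (by exact_mod_cast htl)
    have h2 : 1 ≤ kf * (n : ℝ) ^ α :=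
      one_le_mul_of_one_le_of_one_le (hk₀.trans hkf1) (Real.one_le_rpow hn1 hα.le)
    push_cast
    exact h1.trans (le_mul_of_one_le_left (by positivity) h2)
  set X₀ : Finset (Sym2 (Fin n)) := Finset.univ.filter fun e => ¬ e.IsDiag with hX₀
  -- The tilt y_i = (i+1) λ log γ makes exp(-y_i) = γ^(-λ(i+1)), so that q exp(-y_i) N_(i+1) = k₀ x
  -- θ^(i+1) is summable. The factor i+1 it puts on the fingerprint sizes is harmless against θ^i.
  obtain ⟨L, hL1, hL2, hL3⟩ := exists_container_family (P := FreeSet H)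
    (fun I J hJ hIJ => hJ.mono hIJ) (X₀ := X₀)
    (N := fun i => kf * (n : ℝ) ^ α * γ ^ i) (s := fun i => A * (x * θ ^ i + Z))
    (y := fun i => ((i : ℝ) + 1) * (lam * ℓγ)) hq.le (fun i => by positivity)
    (fun i => by positivity) (fun i => by positivity) (by
      intro i X hX hXl hXu
      have hk : (X.card : ℝ) = (X.card / (n : ℝ) ^ α) * (n : ℝ) ^ α := by field_simp
      set k : ℝ := X.card / (n : ℝ) ^ α with hkdef
      have hkl : kf * γ ^ i ≤ k := by
        rw [hkdef, le_div_iff₀ hnα]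
        refine le_trans (le_of_eq ?_) hXl.le
        ring
      have hkk : k₀ ≤ k := hkf1.trans
        ((le_mul_of_one_le_right hkf0.le (one_le_pow₀ hγ1.le)).trans hkl)
      obtain ⟨T, hT⟩ := hstep n X k (by omega)
        (fun e he => (Finset.mem_filter.1 (hX he)).2) hk hkk
      refine ⟨T, fun I hI hIX => ?_⟩
      obtain ⟨h1, h2, h3, h4⟩ := hT I hI hIX
      refine ⟨h1.trans ?_, h2, h3, h4.trans ?_⟩
      · have hkpow : k ^ (1 - lam) ≤ q ^ (1 - 1 / lam) * θ ^ i := by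
          calc k ^ (1 - lam) ≤ (kf * γ ^ i) ^ (1 - lam) :=
                Real.rpow_le_rpow_of_nonpos (by positivity) hkl (by linarith)
            _ = k₀ ^ (1 - lam) * (q ^ (1 - 1 / lam) * θ ^ i) := by
                rw [hkf, Real.mul_rpow (by positivity) (by positivity),
                  Real.mul_rpow (by positivity) (by positivity), ← Real.rpow_mul hq.le,
                  ← Real.rpow_natCast, ← Real.rpow_mul hγ0.le, hθ, ← Real.rpow_natCast,
                  ← Real.rpow_mul hγ0.le, mul_comm (i : ℝ), mul_assoc]
                congr 3
                field_simp
                ring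
            _ ≤ _ := mul_le_of_le_one_left (by positivity)
                (Real.rpow_le_one_of_one_le_of_nonpos hk₀ (by linarith))
        have := mul_le_mul_of_nonneg_right hkpow hnα.le
        refine mul_le_mul_of_nonneg_left ?_ hA.le
        rw [hx]
        linarith
      · calc (1 - δ) * (X.card : ℝ) ≤ (1 - δ) * (kf * (n : ℝ) ^ α * γ ^ (i + 1)) := by gcongr
          _ = ((1 - δ) * γ) * (kf * (n : ℝ) ^ α * γ ^ i) := by ring
          _ = _ := by rw [hγ, mul_inv_cancel₀ h1δ.ne', one_mul]) t X₀ subset_rfl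
    (le_trans (by exact_mod_cast card_finset_sym2_le X₀) hNt)
  have hsum1 : ∑ i ∈ Finset.range t, A * (x * θ ^ i + Z) ≤ A * (g + W) * x := by
    rw [← Finset.mul_sum, Finset.sum_add_distrib, ← Finset.mul_sum]
    have h1 := mul_le_mul_of_nonneg_left (sum_range_pow_le hθ0.le hθ1 t) hx0.le
    have h2 : ∑ i ∈ Finset.range t, Z ≤ W * x := by
      rw [Finset.sum_const, Finset.card_range, nsmul_eq_mul, mul_comm]
      refine le_trans (mul_le_mul_of_nonneg_left ?_ hZ0.le) hZt
      have : t ≤ t ^ 2 := Nat.le_self_pow two_ne_zero t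
      exact_mod_cast this
    calc _ ≤ A * (x * g + W * x) := by gcongr
      _ = _ := by ring
  have hsum2 : ∑ i ∈ Finset.range t, (((i : ℝ) + 1) * (lam * ℓγ) * (A * (x * θ ^ i + Z)) +
      q * Real.exp (-(((i : ℝ) + 1) * (lam * ℓγ))) * (kf * (n : ℝ) ^ α * γ ^ (i + 1))) ≤
      ((lam * ℓγ * A + k₀) * g + lam * ℓγ * A * W) * x := by
    have hterm : ∀ i : ℕ, ((i : ℝ) + 1) * (lam * ℓγ) * (A * (x * θ ^ i + Z)) +
      q * Real.exp (-(((i : ℝ) + 1) * (lam * ℓγ))) * (kf * (n : ℝ) ^ α * γ ^ (i + 1)) ≤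
        (lam * ℓγ * A + k₀) * x * (((i : ℝ) + 1) * θ ^ i) +
          lam * ℓγ * A * Z * ((i : ℝ) + 1) := by
      intro i
      have e1 : q * Real.exp (-(((i : ℝ) + 1) * (lam * ℓγ))) * (kf * (n : ℝ) ^ α * γ ^ (i + 1)) =
          k₀ * x * θ ^ (i + 1) := by
        have : Real.exp (-(((i : ℝ) + 1) * (lam * ℓγ))) =
            Real.exp (-(lam * ℓγ)) ^ (i + 1) := by
          rw [← Real.exp_nat_mul]; congr 1; push_cast; ring
        rw [this, ← hθexp, ← hqkf, mul_pow]; ring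
      have e2 : k₀ * x * θ ^ (i + 1) ≤ k₀ * x * (((i : ℝ) + 1) * θ ^ i) := by
        refine mul_le_mul_of_nonneg_left ?_ (by positivity)
        rw [pow_succ, mul_comm]
        refine mul_le_mul_of_nonneg_right ?_ (by positivity)
        have : (0 : ℝ) ≤ i := by positivity
        linarith
      rw [e1]
      refine (add_le_add_right e2 _).trans (le_of_eq (by ring))
    refine (Finset.sum_le_sum fun i _ => hterm i).trans ?_
    rw [Finset.sum_add_distrib, ← Finset.mul_sum, ← Finset.mul_sum]
    have h1 := mul_le_mul_of_nonneg_left (sum_range_succ_mul_pow_le hθ0.le hθ1 t)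
      (show 0 ≤ (lam * ℓγ * A + k₀) * x by positivity)
    have h2 := mul_le_mul_of_nonneg_left (sum_range_succ_le_sq t)
      (show 0 ≤ lam * ℓγ * A * Z by positivity)
    have h3 := mul_le_mul_of_nonneg_left hZt (show 0 ≤ lam * ℓγ * A by positivity)
    calc _ ≤ (lam * ℓγ * A + k₀) * x * g + lam * ℓγ * A * (W * x) := by
          rw [mul_assoc (lam * ℓγ * A)] at h2
          rw [mul_assoc (lam * ℓγ * A)]
          linarith
      _ = _ := by ring
  have p1 : 0 ≤ (lam * ℓγ * A + k₀) * g * x := by positivity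
  have p2 : 0 ≤ lam * ℓγ * A * W * x := by positivity
  have p3 : 0 ≤ A * (g + W) * x := by positivity
  have p4 : 0 ≤ k₀ * x := by positivity
  refine ⟨L, fun c hc => ?_, fun I hI hId => ?_, hL3.trans (Real.exp_le_exp.2 ?_)⟩
  · obtain ⟨-, -, h3, h4, h5⟩ := hL1 c hc
    refine ⟨h3, (h4.trans hsum1).trans ?_, ?_⟩
    · simp only [add_mul _ _ x]
      linarith
    · simp only [pow_zero, mul_one] at h5
      have := mul_le_mul_of_nonneg_left h5 hq.le
      rw [hqkf] at this
      simp only [add_mul _ _ x]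
      linarith
  · exact hL2 I hI fun e he => Finset.mem_filter.2 ⟨Finset.mem_univ _, hId e he⟩
  · refine hsum2.trans ?_
    simp only [add_mul _ _ x]
    linarith

/-! ### The binomial random graph and the deletion method -/

open MeasureTheory in
theorem measurableSet_subset_edgeSet {n : ℕ} (A : Finset (Sym2 (Fin n))) :
    MeasurableSet {G : SimpleGraph (Fin n) | (A : Set (Sym2 (Fin n))) ⊆ G.edgeSet} := by
  have : {G : SimpleGraph (Fin n) | (A : Set (Sym2 (Fin n))) ⊆ G.edgeSet} =
      SimpleGraph.edgeSet ⁻¹' (⋂ e ∈ A, {s | e ∈ s}) := by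
    ext G; simp [Set.subset_def]
  rw [this]
  exact SimpleGraph.measurable_edgeSet (Finset.measurableSet_biInter _ fun e _ =>
    measurableSet_setOfPred.2 (measurable_set_mem e))

open MeasureTheory ProbabilityTheory in
theorem setBernoulli_real_superset {ι : Type*} [Countable ι] (u : Set ι) (p : unitInterval)
    (A : Finset ι) (hA : ∀ e ∈ A, e ∈ u) :
    (setBernoulli u p).real {s | (A : Set ι) ⊆ s} = (p : ℝ) ^ A.card := by
  have h1 : setBernoulli u p {s | (A : Set ι) ⊆ s} =
      ((unitInterval.toNNReal p : NNReal) : ENNReal) ^ A.card := by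
    rw [setBernoulli_apply']
    have : (fun p : ι → Prop ↦ {i | p i}) ⁻¹' {s | (A : Set ι) ⊆ s} =
        (A : Set ι).pi fun _ => {True} := by
      ext f; simp [Set.subset_def, Set.pi]
    rw [this, Measure.infinitePi_pi _ (fun _ _ => MeasurableSet.singleton _)]
    rw [← Finset.prod_const]
    refine Finset.prod_congr rfl fun e he => ?_
    simp [hA e he]
  rw [measureReal_def, h1]
  simp

open MeasureTheory ProbabilityTheory in
/-- The probability that the binomial random graph contains a given set of edges. -/
theorem binomialRandom_real_superset {n : ℕ} (p : unitInterval) (A : Finset (Sym2 (Fin n)))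
    (hA : ∀ e ∈ A, ¬ e.IsDiag) :
    (SimpleGraph.binomialRandom (Fin n) p).real
      {G : SimpleGraph (Fin n) | (A : Set (Sym2 (Fin n))) ⊆ G.edgeSet} = (p : ℝ) ^ A.card := by
  rw [SimpleGraph.binomialRandom_eq_map, map_measureReal_apply
    SimpleGraph.measurable_fromEdgeSet (measurableSet_subset_edgeSet A)]
  rw [← setBernoulli_real_superset Sym2.diagSetᶜ p A (fun e he => by simpa using hA e he)]
  congr 1
  ext s
  simp only [Set.mem_preimage, Set.mem_ofPred_eq, SimpleGraph.edgeSet_fromEdgeSet]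
  constructor
  · exact fun h => h.trans Set.sdiff_subset
  · exact fun h e he => ⟨h he, by simpa using hA e he⟩

theorem card_notDiag (n : ℕ) :
    (Finset.univ.filter fun e : Sym2 (Fin n) => ¬ e.IsDiag).card = n.choose 2 := by
  have := Sym2.card_subtype_not_diag (α := Fin n)
  rwa [Fintype.card_subtype, Fintype.card_fin] at this

theorem le_card_notDiag {n : ℕ} (hn : 2 ≤ n) : (n : ℝ) ^ 2 / 4 ≤ n.choose 2 := by
  rw [Nat.cast_choose_two]
  have : (2 : ℝ) ≤ n := by exact_mod_cast hn
  nlinarith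

open MeasureTheory in
/-- The deletion method. -/
theorem exists_free_of_deletion {V : Type} [Finite V] {F : SimpleGraph V} (hF : F ≠ ⊥) (n : ℕ)
    (p : unitInterval) : ∃ G : SimpleGraph (Fin n), F.Free G ∧
      n.choose 2 * (p : ℝ) - (n : ℝ) ^ Nat.card V * (p : ℝ) ^ F.edgeSet.ncard ≤
        (G.edgeSet.ncard : ℝ) := by
  classical
  have := Fintype.ofFinite V
  set P := SimpleGraph.binomialRandom (Fin n) p with hP
  set X := Finset.univ.filter fun e : Sym2 (Fin n) => ¬ e.IsDiag with hX
  set J := Finset.univ.filter fun f : V → Fin n => f.Injective with hJ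
  let ev : Finset (Sym2 (Fin n)) → Set (SimpleGraph (Fin n)) :=
    fun A => {G | (A : Set (Sym2 (Fin n))) ⊆ G.edgeSet}
  have hint : ∀ A, Integrable ((ev A).indicator (1 : SimpleGraph (Fin n) → ℝ)) P := fun A =>
    (integrable_const (1 : ℝ)).indicator (measurableSet_subset_edgeSet A)
  have hintX : Integrable (fun G => ∑ e ∈ X, (ev {e}).indicator (1 : SimpleGraph (Fin n) → ℝ) G) P :=
    integrable_finsetSum _ fun e _ => hint _
  have hintJ : Integrable
      (fun G => ∑ f ∈ J, (ev (copyEdges F f)).indicator (1 : SimpleGraph (Fin n) → ℝ) G) P :=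
    integrable_finsetSum _ fun e _ => hint _
  -- Some graph attains at least the expectation of edges minus labelled copies of `F`; `killCopies`
  -- then removes at most one edge per copy.
  obtain ⟨G, hG⟩ := exists_integral_le (hintX.sub hintJ)
  have hreal : ∀ A, (∀ e ∈ A, ¬ e.IsDiag) →
      ∫ G, (ev A).indicator (1 : SimpleGraph (Fin n) → ℝ) G ∂P = (p : ℝ) ^ A.card := fun A hA => by
    rw [integral_indicator_one (measurableSet_subset_edgeSet A)]
    exact binomialRandom_real_superset p A hA
  have hvalue : n.choose 2 * (p : ℝ) - (n : ℝ) ^ Nat.card V * (p : ℝ) ^ F.edgeSet.ncard ≤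
      ∑ e ∈ X, (ev {e}).indicator (1 : SimpleGraph (Fin n) → ℝ) G -
        ∑ f ∈ J, (ev (copyEdges F f)).indicator (1 : SimpleGraph (Fin n) → ℝ) G := by
    refine le_trans ?_ hG
    simp only [Pi.sub_apply]
    rw [integral_sub hintX hintJ, integral_finsetSum _ fun e _ => hint _,
      integral_finsetSum _ fun e _ => hint _]
    have h1 : ∑ e ∈ X, ∫ G, (ev {e}).indicator (1 : SimpleGraph (Fin n) → ℝ) G ∂P =
        n.choose 2 * (p : ℝ) := by
      rw [← card_notDiag n, ← nsmul_eq_mul]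
      refine Finset.sum_eq_card_nsmul fun e he => ?_
      rw [hreal {e} (by simpa [hX] using he)]
      simp
    have h2 : ∑ f ∈ J, ∫ G, (ev (copyEdges F f)).indicator (1 : SimpleGraph (Fin n) → ℝ) G ∂P ≤
        (n : ℝ) ^ Nat.card V * (p : ℝ) ^ F.edgeSet.ncard := by
      have hc : (J.card : ℝ) ≤ (n : ℝ) ^ Nat.card V := by
        have : J.card ≤ n ^ Nat.card V := (Finset.card_le_univ J).trans (by simp)
        exact_mod_cast this
      have hterm : ∀ f ∈ J, ∫ G, (ev (copyEdges F f)).indicator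
          (1 : SimpleGraph (Fin n) → ℝ) G ∂P = (p : ℝ) ^ F.edgeSet.ncard := by
        intro f hf
        have hfi : f.Injective := (Finset.mem_filter.1 hf).2
        rw [hreal, card_copyEdges F hfi]
        intro e he
        obtain ⟨e', he', rfl⟩ := mem_copyEdges.1 he
        rw [Sym2.isDiag_map hfi]
        exact F.not_isDiag_of_mem_edgeSet he'
      rw [Finset.sum_eq_card_nsmul hterm, nsmul_eq_mul]
      exact mul_le_mul_of_nonneg_right hc (pow_nonneg p.2.1 _)
    linarith
  have hedges : ∑ e ∈ X, (ev {e}).indicator (1 : SimpleGraph (Fin n) → ℝ) G ≤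
      (G.edgeFinset.card : ℝ) := by
    have : ∀ e, (ev {e}).indicator (1 : SimpleGraph (Fin n) → ℝ) G =
        if e ∈ G.edgeFinset then 1 else 0 := fun e => by
      simp [Set.indicator_apply, ev]
    simp only [this]
    rw [← Finset.sum_filter, Finset.sum_const, nsmul_eq_mul, mul_one]
    exact_mod_cast Finset.card_le_card fun e he => (Finset.mem_filter.1 he).2
  have hcopies : (G.copyCount F : ℝ) ≤
      ∑ f ∈ J, (ev (copyEdges F f)).indicator (1 : SimpleGraph (Fin n) → ℝ) G := by
    have : ∀ f, (ev (copyEdges F f)).indicator (1 : SimpleGraph (Fin n) → ℝ) G =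
        if ((copyEdges F f : Finset (Sym2 (Fin n))) : Set (Sym2 (Fin n))) ⊆ G.edgeSet
          then 1 else 0 := fun f => by
      simp [Set.indicator_apply, ev]
    simp only [this]
    rw [← Finset.sum_filter, Finset.sum_const, nsmul_eq_mul, mul_one]
    have hle : G.labelledCopyCount F ≤ (J.filter fun f =>
        ((copyEdges F f : Finset (Sym2 (Fin n))) : Set (Sym2 (Fin n))) ⊆ G.edgeSet).card := by
      rw [labelledCopyCount_eq_natCard]
      refine (Nat.card_le_card_of_injective (fun φ : F.Copy G =>
        (⟨φ, Finset.mem_filter.2 ⟨Finset.mem_filter.2 ⟨Finset.mem_univ _, φ.injective⟩, ?_⟩⟩ :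
          {f // f ∈ J.filter fun f =>
            ((copyEdges F f : Finset (Sym2 (Fin n))) : Set (Sym2 (Fin n))) ⊆ G.edgeSet})) ?_).trans
          (Nat.card_eq_fintype_card.trans (Fintype.card_coe _)).le
      · intro e he
        obtain ⟨e', he', rfl⟩ := mem_copyEdges.1 he
        induction e' with
        | _ a b => exact φ.toHom.map_adj ((SimpleGraph.mem_edgeSet F).1 he')
      · intro φ ψ h
        exact SimpleGraph.Copy.ext fun v => congrFun (Subtype.ext_iff.1 h) v
    exact_mod_cast SimpleGraph.copyCount_le_labelledCopyCount.trans hle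
  refine ⟨G.killCopies F, SimpleGraph.free_killCopies hF, ?_⟩
  have hk : (G.edgeFinset.card : ℝ) ≤ (G.killCopies F).edgeFinset.card + G.copyCount F := by
    have := SimpleGraph.le_card_edgeFinset_killCopies_add_copyCount (G := G) (H := F)
    exact_mod_cast this
  have he : (G.killCopies F).edgeSet.ncard = (G.killCopies F).edgeFinset.card := by
    rw [Set.ncard_eq_toFinset_card', SimpleGraph.edgeFinset]
  rw [he]
  linarith

theorem ncard_edgeSet_le_extremalNumber {V : Type*} {H : SimpleGraph V} {n : ℕ}
    {F : SimpleGraph (Fin n)} (hF : H.Free F) :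
    F.edgeSet.ncard ≤ SimpleGraph.extremalNumber n H := by
  classical
  have := SimpleGraph.card_edgeFinset_le_extremalNumber hF
  rw [Fintype.card_fin] at this
  rw [Set.ncard_eq_toFinset_card']
  exact this

/-- A polynomial upper bound on the Turán number bounds the density of all subgraphs. -/
theorem sub_one_mul_le_of_extremalNumber_le {V : Type*} [Finite V] {H : SimpleGraph V} {α A : ℝ}
    (hα2 : α < 2)
    (hex : ∀ n : ℕ, (SimpleGraph.extremalNumber n H : ℝ) ≤ A * (n : ℝ) ^ α)
    (F : H.Subgraph) :
    ((F.edgeSet.ncard : ℝ) - 1) * (2 - α) ≤ max 0 ((F.verts.ncard : ℝ) - 2) := by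
  by_contra hcon
  push Not at hcon
  set e : ℝ := (F.edgeSet.ncard : ℝ) with he
  set v : ℝ := (F.verts.ncard : ℝ) with hv
  have h2α : 0 < 2 - α := by linarith
  have hpos : 0 < (e - 1) * (2 - α) := lt_of_le_of_lt (le_max_left _ _) hcon
  have hv' : v - 2 < (e - 1) * (2 - α) := lt_of_le_of_lt (le_max_right _ _) hcon
  have he1 : 0 < e - 1 := by
    by_contra h
    push Not at h
    nlinarith
  -- With p = n^(-γ), the lower bound on γ makes n^v p^e negligible against n² p, and the upper
  -- bound makes n² p exceed every multiple of n^α eventually.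
  obtain ⟨γ, hγ1, hγ2⟩ : ∃ γ, max 0 ((v - 2) / (e - 1)) < γ ∧ γ < 2 - α :=
    exists_between (max_lt h2α (by rw [div_lt_iff₀ he1]; linarith))
  have hγ0 : 0 < γ := lt_of_le_of_lt (le_max_left _ _) hγ1
  have hγv : v - 2 < (e - 1) * γ := by
    have := lt_of_le_of_lt (le_max_right _ _) hγ1
    rw [div_lt_iff₀ he1] at this; linarith
  classical
  have := Fintype.ofFinite F.verts
  -- The subgraph is transported to a `Fin` type because the deletion lemma is stated for `V :
  -- Type`.
  set F' := F.coe.overFin rfl with hF'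
  have hFe : F'.edgeSet.ncard = F.edgeSet.ncard := by
    rw [← SimpleGraph.Subgraph.image_coe_edgeSet_coe,
      Set.ncard_image_of_injective _ (Sym2.map.injective Subtype.val_injective)]
    exact (Nat.card_congr (F.coe.overFinIso rfl).mapEdgeSet).symm
  have hbot : F' ≠ ⊥ := by
    intro hb
    rw [hb, SimpleGraph.edgeSet_bot, Set.ncard_empty] at hFe
    rw [he, ← hFe] at he1
    norm_num at he1
  have key : ∀ n : ℕ, 2 ≤ n → (1 : ℝ) / 4 ≤ A * (n : ℝ) ^ (-(2 - α - γ)) +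
      (n : ℝ) ^ (-((e - 1) * γ - (v - 2))) := by
    intro n hn
    have hn0 : (0 : ℝ) < n := by positivity
    have hn1 : (1 : ℝ) ≤ n := by exact_mod_cast (by omega : 1 ≤ n)
    let p : unitInterval := ⟨(n : ℝ) ^ (-γ), by positivity,
      Real.rpow_le_one_of_one_le_of_nonpos hn1 (by linarith)⟩
    obtain ⟨G, hG1, hG2⟩ := exists_free_of_deletion hbot n p
    have hGH : H.Free G := fun hc => hG1
      ((F.coe.overFinIso rfl).isContained'.trans (F.coe_isContained.trans hc))
    have h3 : (G.edgeSet.ncard : ℝ) ≤ A * (n : ℝ) ^ α := by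
      exact le_trans (by exact_mod_cast ncard_edgeSet_le_extremalNumber hGH) (hex n)
    rw [hFe, Nat.card_eq_fintype_card, Fintype.card_fin, ← Nat.card_eq_fintype_card,
      Nat.card_coe_set_eq] at hG2
    have h4 : (n : ℝ) ^ 2 / 4 * (n : ℝ) ^ (-γ) ≤ A * (n : ℝ) ^ α +
        (n : ℝ) ^ F.verts.ncard * ((n : ℝ) ^ (-γ)) ^ F.edgeSet.ncard := by
      have := mul_le_mul_of_nonneg_right (le_card_notDiag hn) (show 0 ≤ (n : ℝ) ^ (-γ) by positivity)
      linarith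
    have e1 : (n : ℝ) ^ 2 * (n : ℝ) ^ (-γ) = (n : ℝ) ^ (2 - γ) := by
      rw [← Real.rpow_natCast, ← Real.rpow_add hn0]; congr 1
    have e2 : (n : ℝ) ^ α = (n : ℝ) ^ (2 - γ) * (n : ℝ) ^ (-(2 - α - γ)) := by
      rw [← Real.rpow_add hn0]; congr 1; ring
    have e3 : (n : ℝ) ^ F.verts.ncard * ((n : ℝ) ^ (-γ)) ^ F.edgeSet.ncard =
        (n : ℝ) ^ (2 - γ) * (n : ℝ) ^ (-((e - 1) * γ - (v - 2))) := by
      rw [← Real.rpow_natCast, ← Real.rpow_natCast, ← Real.rpow_mul hn0.le, ← Real.rpow_add hn0,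
        ← Real.rpow_add hn0]
      congr 1; rw [he, hv]; ring
    rw [e2, e3, div_mul_eq_mul_div, e1] at h4
    have h5 : 0 < (n : ℝ) ^ (2 - γ) := by positivity
    refine le_of_mul_le_mul_left ?_ h5
    linarith
  have lim : Tendsto (fun n : ℕ => A * (n : ℝ) ^ (-(2 - α - γ)) +
      (n : ℝ) ^ (-((e - 1) * γ - (v - 2)))) atTop (𝓝 (A * 0 + 0)) :=
    (((tendsto_rpow_neg_atTop (by linarith)).comp tendsto_natCast_atTop_atTop).const_mul A).add
      ((tendsto_rpow_neg_atTop (by linarith)).comp tendsto_natCast_atTop_atTop)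
  have := ge_of_tendsto lim (eventually_atTop.2 ⟨2, key⟩)
  norm_num at this

/-! ### From containers to probabilities -/

/-- The largest `H`-free subgraph of `G`, as a set of edges. -/
theorem exists_freeSet_card_eq_exIn {V : Type*} {H : SimpleGraph V} (hH : H ≠ ⊥) {n : ℕ}
    (G : SimpleGraph (Fin n)) : ∃ I : Finset (Sym2 (Fin n)), FreeSet H I ∧
      (I : Set (Sym2 (Fin n))) ⊆ G.edgeSet ∧ I.card = exIn G H := by
  classical
  -- The supremum in `exIn` is attained: the empty graph is `H`-free as `H ≠ ⊥`, and all values are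
  -- at most e(G).
  have hmem := Nat.sSup_mem (s := {m : ℕ | ∃ F : SimpleGraph (Fin n), F ≤ G ∧ H.Free F ∧
    m = F.edgeSet.ncard}) ⟨_, ⊥, bot_le, SimpleGraph.free_bot hH, rfl⟩ ⟨G.edgeSet.ncard, by
      rintro m ⟨F, hF, -, rfl⟩
      exact Set.ncard_le_ncard (SimpleGraph.edgeSet_mono hF)⟩
  obtain ⟨F, hFG, hF, hm⟩ := hmem
  refine ⟨F.edgeFinset, ?_, by simpa using hFG, ?_⟩
  · unfold FreeSet
    rwa [SimpleGraph.coe_edgeFinset, SimpleGraph.fromEdgeSet_edgeSet]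
  · rw [exIn, hm, Set.ncard_eq_toFinset_card', SimpleGraph.edgeFinset]

open MeasureTheory in
/-- A container family bounds the probability of a large `H`-free subgraph. -/
theorem binomialRandom_exIn_le {V : Type*} {H : SimpleGraph V} (hH : H ≠ ⊥) {n : ℕ} {A q x : ℝ}
    (hA : 0 < A) (hx : 0 ≤ x) {L : Finset (Finset (Sym2 (Fin n)) × Finset (Sym2 (Fin n)))}
    (hL1 : ∀ c ∈ L, Disjoint c.1 c.2 ∧ (c.1.card : ℝ) ≤ A * x ∧ q * (c.2.card : ℝ) ≤ A * x)
    (hL2 : ∀ I, FreeSet H I → (∀ e ∈ I, ¬ e.IsDiag) → ∃ c ∈ L, c.1 ⊆ I ∧ I ⊆ c.1 ∪ c.2)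
    (hL3 : ∑ c ∈ L, q ^ c.1.card ≤ Real.exp (A * x)) (p : unitInterval) (hpq : (p : ℝ) ≤ q) :
    (SimpleGraph.binomialRandom (Fin n) p).real
      {G | ¬ (exIn G H : ℝ) ≤ (5 * A + 1) * x} ≤ Real.exp (-x) := by
  classical
  set P := SimpleGraph.binomialRandom (Fin n) p with hP
  have : IsProbabilityMeasure P := by rw [hP]; infer_instance
  have hp0 : 0 ≤ (p : ℝ) := p.2.1
  have hq0 : 0 ≤ q := hp0.trans hpq
  set r : ℝ := (4 * A + 1) * x with hr
  -- Removing a fingerprint of size at most Ax leaves at least (4A+1)x = r edges in the container.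
  -- The tilted sum costs 3Ax and the fingerprints Ax, so the exponents add up to -x.
  have hsub : {G : SimpleGraph (Fin n) | ¬ (exIn G H : ℝ) ≤ (5 * A + 1) * x} ⊆
      ⋃ c ∈ L, ⋃ T ∈ c.2.powerset.filter (fun T => r ≤ (T.card : ℝ)),
        {G | ((c.1 ∪ T : Finset (Sym2 (Fin n))) : Set (Sym2 (Fin n))) ⊆ G.edgeSet} := by
    intro G hG
    simp only [Set.mem_ofPred_eq, not_le] at hG
    obtain ⟨I, hI1, hI2, hI3⟩ := exists_freeSet_card_eq_exIn hH G
    obtain ⟨c, hc, hc1, hc2⟩ := hL2 I hI1 fun e he => G.not_isDiag_of_mem_edgeSet (hI2 he)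
    simp only [Set.mem_iUnion]
    refine ⟨c, hc, I \ c.1, ?_, ?_⟩
    · rw [Finset.mem_filter, Finset.mem_powerset]
      refine ⟨fun e he => ?_, ?_⟩
      · rw [Finset.mem_sdiff] at he
        exact (Finset.mem_union.1 (hc2 he.1)).resolve_left he.2
      · rw [Finset.cast_card_sdiff hc1, hI3, hr]
        have := (hL1 c hc).2.1
        linarith
    · rw [Set.mem_ofPred_eq, Finset.union_sdiff_of_subset hc1]
      exact hI2
  have hdiag : ∀ B : Finset (Sym2 (Fin n)),
      P.real {G | (B : Set (Sym2 (Fin n))) ⊆ G.edgeSet} ≤ q ^ B.card := by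
    intro B
    by_cases hB : ∀ e ∈ B, ¬ e.IsDiag
    · rw [hP, binomialRandom_real_superset p B hB]
      exact pow_le_pow_left₀ hp0 hpq _
    · push Not at hB
      obtain ⟨e, he, hed⟩ := hB
      have : {G : SimpleGraph (Fin n) | (B : Set (Sym2 (Fin n))) ⊆ G.edgeSet} = ∅ := by
        ext G
        simp only [Set.mem_ofPred_eq, Set.mem_empty_iff_false, iff_false]
        exact fun h => G.not_isDiag_of_mem_edgeSet (h he) hed
      rw [this]; simp; positivity
  calc P.real {G | ¬ (exIn G H : ℝ) ≤ (5 * A + 1) * x}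
      ≤ _ := measureReal_mono hsub (measure_ne_top _ _)
    _ ≤ ∑ c ∈ L, P.real (⋃ T ∈ c.2.powerset.filter (fun T => r ≤ (T.card : ℝ)),
        {G | ((c.1 ∪ T : Finset (Sym2 (Fin n))) : Set (Sym2 (Fin n))) ⊆ G.edgeSet}) :=
        measureReal_biUnion_finset_le _ _
    _ ≤ ∑ c ∈ L, ∑ T ∈ c.2.powerset.filter (fun T => r ≤ (T.card : ℝ)), q ^ (c.1 ∪ T).card :=
        Finset.sum_le_sum fun c _ => (measureReal_biUnion_finset_le _ _).trans
          (Finset.sum_le_sum fun T _ => hdiag _)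
    _ = ∑ c ∈ L, q ^ c.1.card *
          ∑ T ∈ c.2.powerset.filter (fun T => r ≤ (T.card : ℝ)), q ^ T.card := by
        refine Finset.sum_congr rfl fun c hc => ?_
        rw [Finset.mul_sum]
        refine Finset.sum_congr rfl fun T hT => ?_
        rw [Finset.mem_filter, Finset.mem_powerset] at hT
        rw [← pow_add, Finset.card_union_of_disjoint
          (Finset.disjoint_of_subset_right hT.1 (hL1 c hc).1)]
    _ ≤ ∑ c ∈ L, q ^ c.1.card * Real.exp (-r + 3 * (A * x)) := by
        refine Finset.sum_le_sum fun c hc => mul_le_mul_of_nonneg_left ?_ (by positivity)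
        refine (sum_large_pow_card_le hq0 c.2).trans (Real.exp_le_exp.2 ?_)
        have h1 := (hL1 c hc).2.2
        have h2 : Real.exp 1 ≤ 3 := by linarith [Real.exp_one_lt_d9]
        have h3 : 0 ≤ A * x := by positivity
        have h4 : q * Real.exp 1 * (c.2.card : ℝ) = Real.exp 1 * (q * c.2.card) := by ring
        rw [h4]
        have h5 : Real.exp 1 * (q * c.2.card) ≤ 3 * (A * x) :=
          mul_le_mul h2 h1 (by positivity) (by norm_num)
        linarith
    _ ≤ Real.exp (A * x) * Real.exp (-r + 3 * (A * x)) := by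
        rw [← Finset.sum_mul]; gcongr
    _ = Real.exp (-x) := by rw [← Real.exp_add, hr]; congr 1; ring

/-! ### Bounds on the proper 2-density, and the sparse range -/

/-- A graph with a cycle has at least three edges and contains a path with two edges. -/
theorem exists_path_of_not_isAcyclic {V : Type*} [Finite V] {H : SimpleGraph V}
    (h : ¬ H.IsAcyclic) : 3 ≤ H.edgeSet.ncard ∧
      ∃ a b c : V, H.Adj a b ∧ H.Adj b c ∧ a ≠ c := by
  classical
  unfold SimpleGraph.IsAcyclic at h
  push Not at h
  obtain ⟨v, c, hc⟩ := h
  constructor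
  · have h1 : c.edges.toFinset.card = c.length := by
      rw [List.toFinset_card_of_nodup hc.edges_nodup, SimpleGraph.Walk.length_edges]
    have h2 : (c.edges.toFinset : Set (Sym2 V)) ⊆ H.edgeSet := fun e he =>
      c.edges_subset_edgeSet (by simpa using he)
    have h3 := Set.ncard_le_ncard h2
    rw [Set.ncard_coe_finset, h1] at h3
    exact hc.three_le_length.trans h3
  · have h3 := hc.three_le_length
    have hnd := hc.edges_nodup
    match c, h3, hnd with
    | .cons h1 (.cons h2 w), _, hnd =>
      refine ⟨_, _, _, h1, h2, fun hac => ?_⟩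
      subst hac
      simp only [SimpleGraph.Walk.edges_cons, List.nodup_cons, List.mem_cons, not_or] at hnd
      exact hnd.1.1 Sym2.eq_swap

theorem sub_one_le_properTwoDensity_mul {V : Type*} [Finite V] {H : SimpleGraph V}
    (F : H.Subgraph) (hF : F ≠ ⊤) (hv : 2 < F.verts.ncard) :
    (F.edgeSet.ncard : ℝ) - 1 ≤ properTwoDensity H * ((F.verts.ncard : ℝ) - 2) := by
  have hv' : (0 : ℝ) < (F.verts.ncard : ℝ) - 2 := by
    have : (2 : ℝ) < F.verts.ncard := by exact_mod_cast hv
    linarith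
  rw [← div_le_iff₀ hv']
  exact le_csSup (properTwoDensities_finite H).bddAbove ⟨F, hF, hv, rfl⟩

/-- The witness is a path with two edges; it is proper because `H` has at least three. Thus m*₂ ≥ 1,
and the supremum defining it is over a nonempty set. -/
theorem one_mem_properTwoDensities {V : Type*} [Finite V] {H : SimpleGraph V}
    (h : ¬ H.IsAcyclic) : (1 : ℝ) ∈ properTwoDensities H := by
  obtain ⟨h3, a, b, c, hab, hbc, hac⟩ := exists_path_of_not_isAcyclic h
  set F := H.subgraphOfAdj hab ⊔ H.subgraphOfAdj hbc with hF
  have he : F.edgeSet.ncard = 2 := by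
    rw [hF, SimpleGraph.Subgraph.edgeSet_sup, SimpleGraph.edgeSet_subgraphOfAdj,
      SimpleGraph.edgeSet_subgraphOfAdj, Set.singleton_union, Set.ncard_pair]
    intro heq
    rw [Sym2.eq_iff] at heq
    rcases heq with ⟨h1, h2⟩ | ⟨h1, h2⟩
    · exact hab.ne h1
    · exact hac h1
  have hv : F.verts.ncard = 3 := by
    rw [hF, SimpleGraph.Subgraph.verts_sup, SimpleGraph.subgraphOfAdj_verts,
      SimpleGraph.subgraphOfAdj_verts, Set.ncard_eq_three]
    refine ⟨a, b, c, hab.ne, hac, hbc.ne, ?_⟩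
    ext x
    simp only [Set.mem_union, Set.mem_insert_iff, Set.mem_singleton_iff]
    tauto
  refine ⟨F, fun htop => ?_, by omega, by rw [he, hv]; norm_num⟩
  rw [htop, SimpleGraph.Subgraph.edgeSet_top] at he
  omega

/-- This says λ* ≥ 1. The supremum is attained by a subgraph, to which the deletion bound applies.
-/
theorem properTwoDensity_mul_le_one {V : Type*} [Finite V] {H : SimpleGraph V} {α A : ℝ}
    (h : ¬ H.IsAcyclic) (hα2 : α < 2)
    (hex : ∀ n : ℕ, (SimpleGraph.extremalNumber n H : ℝ) ≤ A * (n : ℝ) ^ α) :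
    properTwoDensity H * (2 - α) ≤ 1 := by
  obtain ⟨F, -, hv, hF⟩ := Set.Nonempty.csSup_mem
    ⟨1, one_mem_properTwoDensities h⟩ (properTwoDensities_finite H)
  have hv' : (0 : ℝ) < (F.verts.ncard : ℝ) - 2 := by
    have : (2 : ℝ) < F.verts.ncard := by exact_mod_cast hv
    linarith
  have := sub_one_mul_le_of_extremalNumber_le hα2 hex F
  rw [max_eq_right hv'.le] at this
  rw [properTwoDensity, hF, div_mul_eq_mul_div, div_le_one hv']
  exact this

theorem exIn_le_extremalNumber {V : Type*} {H : SimpleGraph V} (hH : H ≠ ⊥) {n : ℕ}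
    (G : SimpleGraph (Fin n)) : exIn G H ≤ SimpleGraph.extremalNumber n H := by
  obtain ⟨I, hI1, hI2, hI3⟩ := exists_freeSet_card_eq_exIn hH G
  rw [← hI3, ← Set.ncard_coe_finset]
  refine (Set.ncard_le_ncard fun e he => ?_).trans (ncard_edgeSet_le_extremalNumber hI1)
  rw [SimpleGraph.edgeSet_fromEdgeSet]
  exact ⟨he, G.not_isDiag_of_mem_edgeSet (hI2 he)⟩

open MeasureTheory in
/-- A sparse random graph has no edges, hence no nonempty `H`-free subgraph. -/
theorem binomialRandom_exIn_le_of_sparse {V : Type*} {H : SimpleGraph V} (hH : H ≠ ⊥) {n : ℕ}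
    (p : unitInterval) {R : ℝ} (hR : 0 ≤ R) :
    (SimpleGraph.binomialRandom (Fin n) p).real {G | ¬ (exIn G H : ℝ) ≤ R} ≤
      (n : ℝ) ^ 2 * p := by
  classical
  set X := Finset.univ.filter fun e : Sym2 (Fin n) => ¬ e.IsDiag with hX
  have hsub : {G : SimpleGraph (Fin n) | ¬ (exIn G H : ℝ) ≤ R} ⊆
      ⋃ e ∈ X, {G | (({e} : Finset (Sym2 (Fin n))) : Set (Sym2 (Fin n))) ⊆ G.edgeSet} := by
    intro G hG
    simp only [Set.mem_ofPred_eq, not_le] at hG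
    obtain ⟨I, -, hI2, hI3⟩ := exists_freeSet_card_eq_exIn hH G
    have : 0 < I.card := by
      rw [hI3]
      exact_mod_cast hR.trans_lt hG
    obtain ⟨e, he⟩ := Finset.card_pos.1 this
    simp only [Set.mem_iUnion]
    exact ⟨e, by simpa [hX] using G.not_isDiag_of_mem_edgeSet (hI2 he), by simpa using hI2 he⟩
  calc _ ≤ _ := measureReal_mono hsub (measure_ne_top _ _)
    _ ≤ _ := measureReal_biUnion_finset_le _ _
    _ ≤ X.card • (p : ℝ) := Finset.sum_le_card_nsmul _ _ _ fun e he => by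
        rw [binomialRandom_real_superset p {e} (by simpa [hX] using he)]
        simp
    _ ≤ _ := by
        rw [nsmul_eq_mul]
        refine mul_le_mul_of_nonneg_right ?_ p.2.1
        exact_mod_cast card_finset_sym2_le X

/-! ### Limits and the threshold -/

open MeasureTheory in
theorem tendsto_measure_one_of_real_compl_le {Ω : ℕ → Type*} [∀ n, MeasurableSpace (Ω n)]
    (P : ∀ n, Measure (Ω n)) [∀ n, IsProbabilityMeasure (P n)] (S : ∀ n, Set (Ω n))
    {ε : ℕ → ℝ} (hε : Tendsto ε atTop (𝓝 0)) (h : ∀ᶠ n in atTop, (P n).real (S n)ᶜ ≤ ε n) :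
    Tendsto (fun n => P n (S n)) atTop (𝓝 1) := by
  have h1 : Tendsto (fun n => 1 - ENNReal.ofReal (ε n)) atTop (𝓝 1) := by
    have := ENNReal.Tendsto.sub (tendsto_const_nhds (x := (1 : ENNReal)) (f := atTop))
      (ENNReal.tendsto_ofReal hε) (.inl ENNReal.one_ne_top)
    simpa using this
  refine tendsto_of_tendsto_of_tendsto_of_le_of_le' h1 tendsto_const_nhds ?_
    (.of_forall fun n => prob_le_one)
  filter_upwards [h] with n hn
  rw [tsub_le_iff_right]
  -- Only subadditivity is used, so the events need not be measurable.
  calc (1 : ENNReal) = P n Set.univ := measure_univ.symm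
    _ = P n (S n ∪ (S n)ᶜ) := by rw [Set.union_compl_self]
    _ ≤ P n (S n) + P n (S n)ᶜ := measure_union_le _ _
    _ ≤ _ := by
        gcongr
        rw [← ofReal_measureReal]
        exact ENNReal.ofReal_le_ofReal hn

theorem tendsto_error {β : ℝ} (hβ : 0 < β) :
    Tendsto (fun n : ℕ => (n : ℝ) ^ (-β) + Real.exp (-Real.log n ^ 2)) atTop (𝓝 0) := by
  have h1 := (tendsto_rpow_neg_atTop hβ).comp tendsto_natCast_atTop_atTop
  have h2 : Tendsto (fun n : ℕ => Real.exp (-Real.log n ^ 2)) atTop (𝓝 0) :=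
    Real.tendsto_exp_neg_atTop_nhds_zero.comp
      ((tendsto_pow_atTop two_ne_zero).comp
        (Real.tendsto_log_atTop.comp tendsto_natCast_atTop_atTop))
  simpa using h1.add h2

theorem eventually_log_rpow_le (s : ℝ) {r : ℝ} (hr : 0 < r) :
    ∀ᶠ n : ℕ in atTop, Real.log n ^ s ≤ (n : ℝ) ^ r := by
  have := tendsto_natCast_atTop_atTop.eventually
    ((isLittleO_log_rpow_rpow_atTop s hr).def one_pos)
  filter_upwards [this] with n hn
  rw [one_mul] at hn
  have h0 : (0 : ℝ) ≤ (n : ℝ) ^ r := by positivity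
  rw [Real.norm_of_nonneg h0] at hn
  exact (le_abs_self _).trans hn

/-- The threshold exponents are those for which the two bounds of the theorem coincide at p equal to
the threshold. -/
theorem threshold_rpow {n φ lam : ℝ} (hn : 1 ≤ n) (hlam : 1 < lam) :
    (n ^ (-(φ * lam / (lam - 1))) * Real.log n ^ (2 * lam / (lam - 1))) ^ (1 - 1 / lam) =
      n ^ (-φ) * Real.log n ^ (2 : ℕ) := by
  have hlog : 0 ≤ Real.log n := Real.log_nonneg hn
  have h1 : lam - 1 ≠ 0 := by linarith
  have h2 : lam ≠ 0 := by linarith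
  rw [Real.mul_rpow (by positivity) (by positivity), ← Real.rpow_mul (by linarith),
    ← Real.rpow_mul hlog, ← Real.rpow_natCast]
  congr 2
  · field_simp
  · field_simp
    norm_num

end RandomTuran

/-! ### The main theorem -/

theorem theorem2p4 {V : Type*} [Finite V] (H : SimpleGraph V)
    (hbip : H.IsBipartite) (hcyc : ¬ H.IsAcyclic)
    (α : ℝ) (hα : 0 < α) (hα2 : α < 2)
    (hlam : RandomTuran.lambdaStar H α ≠ 1)
    (hex : ∃ A : ℝ, 0 < A ∧
      ∀ n : ℕ, (SimpleGraph.extremalNumber n H : ℝ) ≤ A * (n : ℝ) ^ α)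
    (hgood : RandomTuran.ErdosSimonovitsGood H α) :
    ∃ C : ℝ, 0 < C ∧ ∀ p : ℕ → unitInterval,
      Tendsto
        (fun n : ℕ => SimpleGraph.binomialRandom (Fin n) (p n)
          {G : SimpleGraph (Fin n) |
            (RandomTuran.exIn G H : ℝ) ≤
              if (p n : ℝ) ≤
                  (n : ℝ) ^ (-(RandomTuran.phi H α * RandomTuran.lambdaStar H α /
                      (RandomTuran.lambdaStar H α - 1))) *
                    Real.log n ^ (2 * RandomTuran.lambdaStar H α /
                      (RandomTuran.lambdaStar H α - 1))
              then C * (n : ℝ) ^ (α - RandomTuran.phi H α) * Real.log n ^ (2 : ℕ)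
              else C * (p n : ℝ) ^ (1 - 1 / RandomTuran.lambdaStar H α) * (n : ℝ) ^ α})
        atTop (𝓝 1) := by
  open RandomTuran in
  obtain ⟨B, hB, hex⟩ := hex
  have h2α : 0 < 2 - α := by linarith
  have hℓ := (exists_path_of_not_isAcyclic hcyc).1
  have hH : H ≠ ⊥ := by
    rintro rfl
    simp at hℓ
  set μ := properTwoDensity H with hμ
  have hμ1 : 1 ≤ μ := le_csSup (properTwoDensities_finite H).bddAbove
    (one_mem_properTwoDensities hcyc)
  have hμα : μ * (2 - α) ≤ 1 := properTwoDensity_mul_le_one hcyc hα2 hex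
  set lam := lambdaStar H α with hlamdef
  have hlameq : lam = 1 / (μ * (2 - α)) := rfl
  have hμα0 : 0 < μ * (2 - α) := by positivity
  have hlam1 : 1 < lam := by
    refine lt_of_le_of_ne ?_ (Ne.symm hlam)
    rw [hlameq, le_div_iff₀ hμα0]; linarith
  have hlaminv : 1 - 1 / lam = 1 - μ * (2 - α) := by rw [hlameq, one_div_one_div]
  have hlam10 : 0 < lam - 1 := by linarith
  have hlam0 : 0 < lam := by linarith
  set φ := phi H α with hφdef
  set thr : ℕ → ℝ := fun n => (n : ℝ) ^ (-(φ * lam / (lam - 1))) *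
    Real.log n ^ (2 * lam / (lam - 1)) with hthr
  have hlog1 : ∀ n : ℕ, 3 ≤ n → 1 ≤ Real.log n := fun n hn => by
    have hn3 : (3 : ℝ) ≤ n := by exact_mod_cast hn
    rw [Real.le_log_iff_exp_le (by linarith)]
    linarith [Real.exp_one_lt_d9]
  -- For φ ≤ 0 and n ≥ 3 the threshold is at least 1, so only the first bound is in force, and it is
  -- at least B n^α.
  rcases le_or_gt φ 0 with hφ | hφ
  · refine ⟨B, hB, fun p => ?_⟩
    refine tendsto_measure_one_of_real_compl_le _ _ tendsto_const_nhds ?_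
    filter_upwards [eventually_ge_atTop 3] with n hn
    have hn1 : (1 : ℝ) ≤ n := by exact_mod_cast (by omega : 1 ≤ n)
    have hp : (p n : ℝ) ≤ thr n := by
      refine (p n).2.2.trans (one_le_mul_of_one_le_of_one_le (Real.one_le_rpow hn1 ?_)
        (Real.one_le_rpow (hlog1 n hn) (by positivity)))
      rw [neg_nonneg]
      exact div_nonpos_of_nonpos_of_nonneg (mul_nonpos_of_nonpos_of_nonneg hφ hlam0.le) hlam10.le
    have hall : {G : SimpleGraph (Fin n) | (exIn G H : ℝ) ≤ if (p n : ℝ) ≤ thr n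
        then B * (n : ℝ) ^ (α - φ) * Real.log n ^ (2 : ℕ)
        else B * (p n : ℝ) ^ (1 - 1 / lam) * (n : ℝ) ^ α} = Set.univ := by
      refine Set.eq_univ_of_forall fun G => ?_
      rw [Set.mem_ofPred_eq, if_pos hp]
      calc (exIn G H : ℝ) ≤ SimpleGraph.extremalNumber n H := by
            exact_mod_cast exIn_le_extremalNumber hH G
        _ ≤ B * (n : ℝ) ^ α := hex n
        _ ≤ B * (n : ℝ) ^ (α - φ) := by
            gcongr
            linarith
        _ ≤ _ := le_mul_of_one_le_right (by positivity) (one_le_pow₀ (hlog1 n hn))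
    rw [hall]
    simp
  · obtain ⟨A, hA, hfam⟩ := exists_freeSet_family (lam := lam) (by omega) hα hα2 (by linarith)
      sub_one_le_properTwoDensity_mul hφ hgood hlameq hlam1
    refine ⟨5 * A + 1, by positivity, fun p => ?_⟩
    refine tendsto_measure_one_of_real_compl_le _ _ (tendsto_error h2α) ?_
    have hc0 : 0 < φ * lam / (lam - 1) := by positivity
    filter_upwards [eventually_ge_atTop 3, eventually_log_rpow_le (2 * lam / (lam - 1)) hc0,
      eventually_log_rpow_le 2 (show 0 < (2 - α) ^ 2 by positivity)] with n hn hn2 hn3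
    have hn0 : (0 : ℝ) < n := by positivity
    have hn1 : (1 : ℝ) ≤ n := by exact_mod_cast (by omega : 1 ≤ n)
    have hl0 : 0 < Real.log n := by linarith [hlog1 n hn]
    have hthr0 : 0 < thr n := by simp only [hthr]; positivity
    have hthr1 : thr n ≤ 1 := by
      simp only [hthr]
      rw [Real.rpow_neg hn0.le, inv_mul_le_iff₀ (by positivity), mul_one]
      exact hn2
    -- Replacing `p` by max(p, threshold) makes both cases of the claim equal to (5A+1)x.
    set q : ℝ := if (p n : ℝ) ≤ thr n then thr n else p n with hq
    have hpq : (p n : ℝ) ≤ q := by rw [hq]; split_ifs with h <;> linarith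
    have htq : thr n ≤ q := by rw [hq]; split_ifs with h <;> linarith
    have hq1 : q ≤ 1 := by
      rw [hq]; split_ifs with h
      · exact hthr1
      · exact (p n).2.2
    have hq0 : 0 < q := by linarith
    set x : ℝ := q ^ (1 - 1 / lam) * (n : ℝ) ^ α with hx
    have hthrx : thr n ^ (1 - 1 / lam) * (n : ℝ) ^ α =
        (n : ℝ) ^ (α - φ) * Real.log n ^ (2 : ℕ) := by
      simp only [hthr]
      rw [threshold_rpow hn1 hlam1, sub_eq_add_neg, Real.rpow_add hn0]; ring
    have hset : {G : SimpleGraph (Fin n) | (exIn G H : ℝ) ≤ if (p n : ℝ) ≤ thr n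
        then (5 * A + 1) * (n : ℝ) ^ (α - φ) * Real.log n ^ (2 : ℕ)
        else (5 * A + 1) * (p n : ℝ) ^ (1 - 1 / lam) * (n : ℝ) ^ α}ᶜ =
        {G | ¬ (exIn G H : ℝ) ≤ (5 * A + 1) * x} := by
      ext G
      rw [Set.mem_compl_iff, Set.mem_ofPred_eq, Set.mem_ofPred_eq, hx, hq]
      split_ifs with h
      · rw [hthrx, mul_assoc]
      · rw [mul_assoc]
    rw [hset]
    have hx0 : 0 ≤ x := by positivity
    have hinv0 : 0 ≤ 1 - 1 / lam := by rw [hlaminv]; linarith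
    -- If `q` is this small, the graph has no edges except with probability at most n^(-(2-α)).
    -- Otherwise `x` is at least a power of `n`, hence at least (log n)².
    rcases le_or_gt q ((n : ℝ) ^ (-(4 - α))) with hsp | hsp
    · refine (binomialRandom_exIn_le_of_sparse hH (p n) (by positivity)).trans ?_
      calc (n : ℝ) ^ 2 * (p n : ℝ) ≤ (n : ℝ) ^ 2 * (n : ℝ) ^ (-(4 - α)) := by
            gcongr; exact hpq.trans hsp
        _ = (n : ℝ) ^ (-(2 - α)) := by
            rw [← Real.rpow_natCast, ← Real.rpow_add hn0]; congr 1; push_cast; ring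
        _ ≤ _ := le_add_of_nonneg_right (Real.exp_pos _).le
    · have hx1 : (n : ℝ) ^ (α - φ) * Real.log n ^ 2 ≤ x := by
        rw [← hthrx, hx]
        gcongr
      have hx2 : Real.log n ^ 2 ≤ x := by
        calc Real.log n ^ 2 ≤ (n : ℝ) ^ ((2 - α) ^ 2) := by
              rw [← Real.rpow_natCast]; exact_mod_cast hn3
          _ ≤ (n : ℝ) ^ (-(4 - α) * (1 - 1 / lam) + α) := by
              refine Real.rpow_le_rpow_of_exponent_le hn1 ?_
              rw [hlaminv]
              -- Since μ ≥ 1, the exponent is at least α - (4-α)(α-1) = (2-α)².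
              nlinarith [mul_nonneg (sub_nonneg.2 hμ1) h2α.le]
          _ = ((n : ℝ) ^ (-(4 - α))) ^ (1 - 1 / lam) * (n : ℝ) ^ α := by
              rw [Real.rpow_add hn0, Real.rpow_mul hn0.le]
          _ ≤ x := by rw [hx]; gcongr
      obtain ⟨L, hL1, hL2, hL3⟩ := hfam n q x hn hq0 hq1 hx hx1 hx2
      refine (binomialRandom_exIn_le hH hA hx0 hL1 hL2 hL3 (p n) hpq).trans ?_
      calc Real.exp (-x) ≤ Real.exp (-Real.log n ^ 2) := Real.exp_le_exp.2 (by linarith)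
        _ ≤ _ := le_add_of_nonneg_left (by positivity)
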